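/- **Symmetric decomposition of B-series methods.** Let $\mathcal H$ be the Butcher–Connes–Kreimer Hopf algebra over $\mathbb R$: the free commutative algebra on the non-empty unlabelled non-planar rooted trees (unit: the empty forest $\emptyset$), with coproduct $\Delta(\tau)=\sum_{c} P_c(\tau)\otimes R_c(\tau)$ over the admissible cuts $c$ of $\tau$, including the empty and the total cut ($P_c$ is the pruned forest and $R_c$ the component of the root; $P_c=\tau$, $R_c=\emptyset$ for the total cut), and antipode $S(\tau)=\sum_{c}(-1)^{|c|+1}\tau^c$ over all sets $c$ of edges of $\tau$, where $\tau^c$ is the forest obtained by deleting the edges in $c$. Let $|\tau|$ be the number of vertices of $\tau$ and $\sigma(\tau)$ the order of its symmetry group. For characters (unital algebra homomorphisms) $\varphi,\varphi_1,\varphi_2:\mathcal H\to\mathbb R$ let $\varphi_1*\varphi_2=\mu_{\mathbb R}\circ(\varphi_1\otimes\varphi_2)\circ\Delta$, and let $\bar\varphi$ and $\varphi^*$ be the characters with $\bar\varphi(\tau)=(-1)^{|\tau|}\varphi(\tau)$ and $\varphi^*(\tau)=(-1)^{|\tau|}\varphi(S\tau)$ on trees. The character $\varphi$ is *even* if $\bar\varphi=\varphi$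 and *odd* if $\bar\varphi=\varphi\circ S$. The B-series method with character $\varphi$ assigns to every $N$ and every smooth vector field $f:\mathbb R^N\to\mathbb R^N$ the formal power series in $h$ $$B_h(\varphi,f)(y)=y+\sum_{\tau\ne\emptyset}\frac{h^{|\tau|}}{\sigma(\tau)}\,\varphi(\tau)\,F(\tau)(y),\qquad F([\tau_1,\dots,\tau_m])(y)=f^{(m)}(y)\big(F(\tau_1)(y),\dots,F(\tau_m)(y)\big),$$ where $[\tau_1,\dots,\tau_m]$ is the tree obtained by joining the roots of $\tau_1,\dots,\tau_m$ to a new root. Methods are composed, $(\Phi\circ\Psi)_h=\Phi_h\circ\Psi_h$, by substitution and Taylor expansion in $h$. The adjoint method is $\Psi^*_h=(\Psi_{-h})^{-1}$, the two-sided inverse with respect to composition; $\Psi$ is *symmetric* if $\Psi=\Psi^*$ and *antisymmetric* if $\Psi_{-h}=\Psi_h$. Then every B-series method $\Psi$, with character $\psi$, can be written as a composition $$\Psi=\Psi^-\circ\Psi^+$$ of two B-series methods, with characters $\psi^-$ and $\psi^+$, where $\Psi^-$ is symmetric and $\psi^-$ is odd, $\Psi^+$ is antisymmetric and $\psi^+$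 is even, and $\psi=\psi^+*\psi^-$. Moreover the adjoint $\Psi^*$ is the B-series method with character $\psi^*$, and $$\Psi^-\circ\Psi^-=\Psi\circ\Psi^*,\qquad \psi^-*\psi^-=\psi^**\psi .$$ -/

import Mathlib

open scoped TensorProduct ContDiff

noncomputable section

namespace BSeries

/-! ## Non-planar rooted trees -/

/-- Finite non-empty planar rooted trees: a root with `n` ordered subtrees. -/
inductive PlanarTree : Type
  | node (n : ℕ) (c : Fin n → PlanarTree) : PlanarTree

/-- Isomorphism of rooted trees: a bijection between the children of the roots under which
corresponding subtrees are isomorphic. -/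
inductive PlanarTree.Iso : PlanarTree → PlanarTree → Prop
  | node {n m : ℕ} {c : Fin n → PlanarTree} {d : Fin m → PlanarTree} (e : Fin n ≃ Fin m)
      (h : ∀ i, PlanarTree.Iso (c i) (d (e i))) : PlanarTree.Iso (.node n c) (.node m d)

theorem PlanarTree.Iso.refl : ∀ t : PlanarTree, PlanarTree.Iso t t
  | .node _ c => .node (Equiv.refl _) fun i => PlanarTree.Iso.refl (c i)

theorem PlanarTree.Iso.symm {s t : PlanarTree} (h : PlanarTree.Iso s t) :
    PlanarTree.Iso t s := by
  induction h with
  | node e _ ih =>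
    refine .node e.symm fun i => ?_
    have := ih (e.symm i)
    rwa [Equiv.apply_symm_apply] at this

theorem PlanarTree.Iso.trans {s t : PlanarTree} (h : PlanarTree.Iso s t) :
    ∀ {u : PlanarTree}, PlanarTree.Iso t u → PlanarTree.Iso s u := by
  induction h with
  | node e _ ih =>
    intro u hu
    cases hu with
    | node e' h' => exact .node (e.trans e') fun i => ih i (h' (e i))

instance PlanarTree.setoid : Setoid PlanarTree where
  r := PlanarTree.Iso
  iseqv := ⟨PlanarTree.Iso.refl, fun h => h.symm, fun h h' => h.trans h'⟩

/-- Unlabelled non-planar rooted trees with at least one vertex. The empty tree is represented by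
the empty forest, i.e. by the unit of the algebra `H` below. -/
def Tree : Type := Quotient PlanarTree.setoid

/-- The non-planar tree underlying a planar one. -/
def Tree.mk (t : PlanarTree) : Tree := Quotient.mk PlanarTree.setoid t

/-- A forest is a commutative juxtaposition of trees; `0` is the empty forest. -/
abbrev Forest : Type := Multiset Tree

instance : DecidableEq Tree := Classical.decEq _

/-- Recursion over planar trees for quantities that depend only on the multiset of the pairs
(subtree at the root, value of the quantity on it). -/
def PlanarTree.para {α : Type*} (g : Multiset (Tree × α) → α) : PlanarTree → α
  | .node _ c =>
      g (Finset.univ.val.map fun i => (Tree.mk (c i), PlanarTree.para g (c i)))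

theorem PlanarTree.para_congr {α : Type*} (g : Multiset (Tree × α) → α) {s t : PlanarTree}
    (h : PlanarTree.Iso s t) : s.para g = t.para g := by
  induction h with
  | @node n m c d e h ih =>
    simp only [PlanarTree.para]
    congr 1
    rw [← Multiset.map_univ_val_equiv e, Multiset.map_map]
    refine Multiset.map_congr rfl fun i _ => ?_
    exact Prod.ext (Quotient.sound (s := PlanarTree.setoid) (h i)) (ih i)

/-- Recursion over non-planar trees. -/
def Tree.para {α : Type*} (g : Multiset (Tree × α) → α) : Tree → α :=
  Quotient.lift (PlanarTree.para g) fun _ _ h => PlanarTree.para_congr g (show PlanarTree.Iso _ _ from h)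

/-- The tree `[τ₁, …, τₖ]` obtained by joining the roots of the trees of a forest to a new root. -/
def Tree.node (s : Forest) : Tree :=
  Tree.mk (.node s.toList.length fun i => Quotient.out (s.toList.get i))

/-- The equation that characterises `Tree.para`. -/
theorem Tree.para_node {α : Type*} (g : Multiset (Tree × α) → α) (s : Forest) :
    (Tree.node s).para g = g (s.map fun τ => (τ, τ.para g)) := by
  have key : ∀ τ : Tree, (Quotient.out τ : PlanarTree).para g = τ.para g := fun τ => by
    conv_rhs => rw [← Quotient.out_eq τ]
    rfl
  have key2 : ∀ τ : Tree, Tree.mk (Quotient.out τ) = τ :=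
    fun τ => Quotient.out_eq τ
  change g _ = _
  congr 1
  simp only [key, key2]
  conv_rhs => rw [← Multiset.coe_toList s]
  rw [Fin.univ_val_map, Multiset.map_coe]
  congr 1
  apply List.ext_get <;> simp

/-- The number `|τ|` of vertices. -/
def Tree.size : Tree → ℕ := Tree.para fun s => 1 + (s.map Prod.snd).sum

/-- The order `σ(τ)` of the symmetry group:
`σ([τ₁^k₁, …, τₘ^kₘ]) = ∏ kᵢ! σ(τᵢ)^kᵢ` for pairwise distinct `τᵢ`. -/
def Tree.symm : Tree → ℕ := Tree.para fun s =>
  (∏ τ ∈ (s.map Prod.fst).toFinset, ((s.map Prod.fst).count τ).factorial) * (s.map Prod.snd).prod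

theorem Tree.finite_size (n : ℕ) : {τ : Tree | τ.size = n}.Finite := by
  let sz : PlanarTree → ℕ := PlanarTree.para fun s => 1 + (s.map Prod.snd).sum
  have hsz : ∀ k (c : Fin k → PlanarTree), sz (.node k c) = 1 + ∑ i, sz (c i) := by
    intro k c
    simp only [sz, PlanarTree.para, Multiset.map_map]
    rfl
  have hpos : ∀ t, 1 ≤ sz t := by
    rintro ⟨k, c⟩
    rw [hsz]
    omega
  have hfin : ∀ n, {t : PlanarTree | sz t < n}.Finite := by
    intro n
    induction n with
    | zero => simp
    | succ n ih =>
      have hU : (⋃ k : Fin (n + 1), (PlanarTree.node (k : ℕ)) ''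
          (Set.univ.pi fun _ : Fin (k : ℕ) => {t : PlanarTree | sz t < n})).Finite :=
        Set.finite_iUnion fun k => (Set.Finite.pi fun _ => ih).image _
      refine hU.subset ?_
      rintro ⟨k, c⟩ hk
      replace hk : sz (.node k c) < n + 1 := hk
      rw [hsz] at hk
      have h1 : ∀ i, sz (c i) ≤ ∑ i, sz (c i) := fun i =>
        Finset.single_le_sum (f := fun i => sz (c i)) (fun _ _ => Nat.zero_le _)
          (Finset.mem_univ i)
      have h2 : k ≤ ∑ i, sz (c i) := by
        calc k = ∑ _i : Fin k, 1 := by simp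
          _ ≤ _ := Finset.sum_le_sum fun i _ => hpos _
      refine Set.mem_iUnion.2 ⟨⟨k, by omega⟩, c, ?_, rfl⟩
      intro i _
      have := h1 i
      change sz (c i) < n
      omega
  refine ((hfin (n + 1)).image Tree.mk).subset ?_
  rintro ⟨t⟩ hτ
  refine ⟨t, ?_, rfl⟩
  have h : sz t = n := hτ
  change sz t < n + 1
  omega

/-- The finite set of trees with `n` vertices. -/
def treesOfSize (n : ℕ) : Finset Tree := (Tree.finite_size n).toFinset

/-! ## The Butcher–Connes–Kreimer Hopf algebra -/

/-- The free commutative algebra on the non-empty trees; the unit is the empty forest. -/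
abbrev H : Type := MvPolynomial Tree ℝ

/-- A forest as a monomial of `H`. -/
def ofForest (s : Forest) : H := (s.map MvPolynomial.X).prod

/-- The pairs `(P_c(τ), R_c(τ))` for all admissible cuts `c` of `τ` except the total cut, with
multiplicity. Such a cut of `[τ₁, …, τₖ]` is a choice, for each `i`, either to cut the edge to
`τᵢ`, so that all of `τᵢ` goes to `P_c` and no further edge of `τᵢ` may be cut, or to keep it and
to take an admissible non-total cut of `τᵢ`. -/
def Tree.admCuts : Tree → Multiset (Forest × Tree) := Tree.para fun s =>
  (Multiset.Sections (s.map fun x =>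
    (({x.1}, 0) : Forest × Forest) ::ₘ
      x.2.map fun c : Forest × Tree => ((c.1, {c.2}) : Forest × Forest))).map
    fun p => ((p.map Prod.fst).sum, Tree.node (p.map Prod.snd).sum)

/-- The pairs (components of `τ^c` without the root, component with the root) for all sets `c` of
edges of `τ`, with multiplicity: for each `i` a set of edges of `τᵢ` is chosen, and the edge to
`τᵢ` is cut or kept. The number `|c|` of cut edges is the number of components without the
root. -/
def Tree.allCuts : Tree → Multiset (Forest × Tree) := Tree.para fun s =>
  (Multiset.Sections (s.map fun x =>
    (x.2.map fun c : Forest × Tree => ((c.1 + {c.2}, 0) : Forest × Forest)) +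
      x.2.map fun c : Forest × Tree => ((c.1, {c.2}) : Forest × Forest))).map
    fun p => ((p.map Prod.fst).sum, Tree.node (p.map Prod.snd).sum)

/-- The coproduct `Δ(τ) = ∑ P_c(τ) ⊗ R_c(τ)` over all admissible cuts; the term
`τ ⊗ ∅` belongs to the total cut. -/
def coproduct : H →ₐ[ℝ] H ⊗[ℝ] H :=
  MvPolynomial.aeval fun τ =>
    MvPolynomial.X τ ⊗ₜ[ℝ] (1 : H) +
      (τ.admCuts.map fun c => ofForest c.1 ⊗ₜ[ℝ] (MvPolynomial.X c.2 : H)).sum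

/-- The antipode `S(τ) = ∑ (-1)^(|c|+1) τ^c` over all sets `c` of edges. -/
def antipode : H →ₐ[ℝ] H :=
  MvPolynomial.aeval fun τ =>
    (τ.allCuts.map fun c =>
      (-1 : H) ^ (Multiset.card c.1 + 1) * (ofForest c.1 * MvPolynomial.X c.2)).sum

/-- The canonical involution `τ ↦ (-1)^|τ| τ`. -/
def involution : H →ₐ[ℝ] H :=
  MvPolynomial.aeval fun τ => (-1 : H) ^ τ.size * MvPolynomial.X τ

/-- Characters of `H`, i.e. the elements of the Butcher group. -/
abbrev Character : Type := H →ₐ[ℝ] ℝ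

/-- The convolution product `φ₁ * φ₂ = μ ∘ (φ₁ ⊗ φ₂) ∘ Δ`. -/
def Character.conv (φ₁ φ₂ : Character) : Character :=
  ((Algebra.TensorProduct.lmul' ℝ).comp (Algebra.TensorProduct.map φ₁ φ₂)).comp coproduct

/-- The character `ζ̄`, `ζ̄(τ) = (-1)^|τ| ζ(τ)`. -/
def Character.bar (ζ : Character) : Character := ζ.comp involution

/-- The inverse `ζ ∘ S` of `ζ` in the Butcher group. -/
def Character.inv (ζ : Character) : Character := ζ.comp antipode

/-- The adjoint character, `ζ*(τ) = (-1)^|τ| ζ(S τ)`. -/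
def Character.adjoint (ζ : Character) : Character :=
  MvPolynomial.aeval fun τ => (-1 : ℝ) ^ τ.size * ζ (antipode (MvPolynomial.X τ))

/-- Even characters: `ζ̄ = ζ`. -/
def Character.IsEven (ζ : Character) : Prop := ζ.bar = ζ

/-- Odd characters: `ζ̄ = ζ⁻¹`. -/
def Character.IsOdd (ζ : Character) : Prop := ζ.bar = ζ.inv

/-! ## Formal one-step methods -/

/-- The space `ℝ^N`. -/
abbrev Space (N : ℕ) : Type := EuclideanSpace ℝ (Fin N)

/-- Smooth vector fields on `ℝ^N`. -/
structure VectorField (N : ℕ) where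
  toFun : Space N → Space N
  smooth : ContDiff ℝ ∞ toFun

/-- Formal power series in the step size `h` whose coefficients are maps `ℝ^N → ℝ^N`: `Ψ n` is
the coefficient of `h ^ n`. -/
abbrev FormalMap (N : ℕ) : Type := ℕ → Space N → Space N

namespace FormalMap

/-- The coefficient of `h ^ l` in the Taylor expansion at `h = 0` of `g(Ψ_h(y))`. Only the
coefficients of `Ψ` up to order `l` contribute. -/
def taylorCoeff {N : ℕ} (g : Space N → Space N) (Ψ : FormalMap N) (l : ℕ) (y : Space N) :
    Space N :=
  (l.factorial : ℝ)⁻¹ • iteratedDeriv l (fun h : ℝ => g (∑ k ∈ Finset.range (l + 1), h ^ k • Ψ k y)) 0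

/-- The composition `Φ_h ∘ Ψ_h` (`Ψ` is applied first), expanded in powers of `h`. -/
def comp {N : ℕ} (Φ Ψ : FormalMap N) : FormalMap N := fun m y =>
  ∑ p ∈ Finset.HasAntidiagonal.antidiagonal m, taylorCoeff (Φ p.1) Ψ p.2 y

/-- The identity map, as a power series in `h`. -/
def id (N : ℕ) : FormalMap N := fun n y => if n = 0 then y else 0

/-- The series `Ψ_{-h}`. -/
def reverse {N : ℕ} (Ψ : FormalMap N) : FormalMap N := fun n y => (-1 : ℝ) ^ n • Ψ n y

end FormalMap

/-- A formal one-step method assigns to every smooth vector field on every `ℝ^N` a formal power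
series in the step size. -/
def Method : Type := ∀ N : ℕ, VectorField N → FormalMap N

namespace Method

/-- Composition `Φ ∘ Ψ` of methods (`Ψ` is applied first). -/
def comp (Φ Ψ : Method) : Method := fun N f => (Φ N f).comp (Ψ N f)

/-- The identity method. -/
def id : Method := fun N _ => FormalMap.id N

/-- The method `Ψ_{-h}`. -/
def reverse (Ψ : Method) : Method := fun N f => (Ψ N f).reverse

/-- `Ψ'` is the adjoint method of `Ψ`, that is, the inverse `Ψ'_h = (Ψ_{-h})⁻¹` of `Ψ_{-h}` with
respect to composition. -/
def IsAdjoint (Ψ Ψ' : Method) : Prop := Ψ'.comp Ψ.reverse = id ∧ Ψ.reverse.comp Ψ' = id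

/-- A method is symmetric if it is its own adjoint. -/
def IsSymmetric (Ψ : Method) : Prop := Ψ.IsAdjoint Ψ

/-- A method is antisymmetric if `Ψ_{-h} = Ψ_h`. -/
def IsAntisymmetric (Ψ : Method) : Prop := Ψ.reverse = Ψ

end Method

/-! ## B-series methods -/

/-- Symmetry of higher derivatives: adjacent arguments can be exchanged. -/
theorem iteratedFDeriv_swap {E F : Type*} [NormedAddCommGroup E] [NormedSpace ℝ E]
    [NormedAddCommGroup F] [NormedSpace ℝ F] {f : E → F} (hf : ContDiff ℝ ∞ f) :
    ∀ (n : ℕ) (i : Fin n) (x : E) (v : Fin (n + 1) → E),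
      iteratedFDeriv ℝ (n + 1) f x (v ∘ Equiv.swap i.castSucc i.succ) =
        iteratedFDeriv ℝ (n + 1) f x v := by
  have hd : ∀ n x, DifferentiableAt ℝ (iteratedFDeriv ℝ n f) x := fun n x =>
    (hf.differentiable_iteratedFDeriv (by exact_mod_cast WithTop.coe_lt_top _)) x
  have hap : ∀ n x u (w : Fin n → E), fderiv ℝ (iteratedFDeriv ℝ n f) x u w =
      fderiv ℝ (fun z => iteratedFDeriv ℝ n f z w) x u := by
    intro n x u w
    rw [fderiv_continuousMultilinear_apply_const_apply (hd n x)]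
  intro n
  induction n with
  | zero => exact fun i => i.elim0
  | succ n ih =>
    intro i x v
    refine Fin.cases ?_ (fun j => ?_) i
    · have hle : (2 : WithTop ℕ∞) + n ≤ ∞ := 
        (WithTop.coe_le_coe.2 (le_top : ((2 + n : ℕ) : ℕ∞) ≤ ⊤))
      have hc : ContDiff ℝ 2 (iteratedFDeriv ℝ n f) := hf.iteratedFDeriv_right hle
      have hs : IsSymmSndFDerivAt ℝ (iteratedFDeriv ℝ n f) x :=
        ContDiffAt.isSymmSndFDerivAt (n := 2) hc.contDiffAt (by simp)
      have hc' : DifferentiableAt ℝ (fderiv ℝ (iteratedFDeriv ℝ n f)) x :=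
        ((hc.fderiv_right (m := 1) (by norm_num)).differentiable (by norm_num)) x
      have h2 : ∀ w : Fin (n + 2) → E, iteratedFDeriv ℝ (n + 2) f x w =
          fderiv ℝ (fderiv ℝ (iteratedFDeriv ℝ n f)) x (w 0) (w 1) (Fin.tail (Fin.tail w)) := by
        intro w
        rw [iteratedFDeriv_succ_apply_left, hap]
        simp only [iteratedFDeriv_succ_apply_left]
        rw [fderiv_continuousMultilinear_apply_const_apply
          (hc'.clm_apply (differentiableAt_const _)), fderiv_clm_apply hc' (differentiableAt_const _)]
        simp [Fin.tail]
      rw [h2, h2, hs.eq]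
      congr 1
    · rw [iteratedFDeriv_succ_apply_left, iteratedFDeriv_succ_apply_left, hap, hap]
      have h0 : (v ∘ Equiv.swap j.succ.castSucc j.succ.succ) 0 = v 0 := by
        simp only [Function.comp]
        rw [Equiv.swap_apply_of_ne_of_ne] <;> simp [Fin.ext_iff]
      have h1 : Fin.tail (v ∘ Equiv.swap j.succ.castSucc j.succ.succ) =
          Fin.tail v ∘ Equiv.swap j.castSucc j.succ := by
        funext k
        simp only [Fin.tail, Function.comp, Equiv.swap_apply_def, ← Fin.succ_castSucc, Fin.succ_inj]
        split_ifs <;> rfl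
      rw [h0, h1]
      simp only [ih]

/-- Symmetry of the higher derivatives of a smooth map. -/
theorem iteratedFDeriv_perm {E F : Type*} [NormedAddCommGroup E] [NormedSpace ℝ E]
    [NormedAddCommGroup F] [NormedSpace ℝ F] {f : E → F} (hf : ContDiff ℝ ∞ f) (n : ℕ)
    (e : Equiv.Perm (Fin n)) (x : E) (v : Fin n → E) :
    iteratedFDeriv ℝ n f x (v ∘ e) = iteratedFDeriv ℝ n f x v := by
  cases n with
  | zero => exact congrArg _ (Subsingleton.elim _ _)
  | succ n =>
    have he : e ∈ Submonoid.closure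
        (Set.range fun i : Fin n => Equiv.swap i.castSucc i.succ) := by
      rw [Equiv.Perm.mclosure_swap_castSucc_succ]
      trivial
    induction he using Submonoid.closure_induction generalizing v with
    | mem _ h =>
      obtain ⟨i, rfl⟩ := h
      exact iteratedFDeriv_swap hf n i x v
    | one => rfl
    | mul a b _ _ iha ihb =>
      rw [Equiv.Perm.coe_mul, ← Function.comp_assoc, ihb, iha]

/-- Elementary differentials along planar trees:
`F([τ₁, …, τₘ])(y) = f^(m)(y)(F(τ₁)(y), …, F(τₘ)(y))`. -/
def PlanarTree.elemDiff {N : ℕ} (f : VectorField N) (y : Space N) : PlanarTree → Space N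
  | .node n c => iteratedFDeriv ℝ n f.toFun y fun i => PlanarTree.elemDiff f y (c i)

theorem PlanarTree.elemDiff_congr {N : ℕ} (f : VectorField N) (y : Space N) {s t : PlanarTree}
    (h : PlanarTree.Iso s t) : s.elemDiff f y = t.elemDiff f y := by
  induction h with
  | @node n m c d e h ih =>
    have hnm : n = m := by simpa using Fintype.card_congr e
    subst hnm
    simp only [PlanarTree.elemDiff, ih]
    exact iteratedFDeriv_perm f.smooth n e y fun i => (d i).elemDiff f y

/-- The elementary differential `F(τ)(y)` of `f`. -/
def Tree.elemDiff {N : ℕ} (f : VectorField N) (y : Space N) : Tree → Space N :=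
  Quotient.lift (PlanarTree.elemDiff f y) fun _ _ h =>
    PlanarTree.elemDiff_congr f y (show PlanarTree.Iso _ _ from h)

/-- The B-series method `∑ h^|τ| / σ(τ) φ(τ) F(τ)(y)` of the character `φ`, the sum being over all
trees. The empty tree has `|∅| = 0`, `σ(∅) = 1`, `F(∅)(y) = y` and gives the coefficient of
`h ^ 0`. -/
def bSeries (φ : Character) : Method := fun _ f n y =>
  if n = 0 then φ 1 • y
  else ∑ τ ∈ treesOfSize n, ((τ.symm : ℝ)⁻¹ * φ (MvPolynomial.X τ)) • τ.elemDiff f y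

end BSeries

end

/-! The characters form a group under convolution (the Butcher group), `Character.bar` is an
involutive automorphism of it, and the adjoint character is ψ* = ψ̄⁻¹. The decomposition is then
pure group theory, given unique square roots. A splitting ψ = ψ⁺ψ⁻ into an even and an odd factor
forces ψ*ψ = (ψ⁻)², so ψ⁻ is taken to be the square root of ψ*ψ. As bar sends ψ*ψ to its inverse,
uniqueness of roots makes ψ⁻ odd, and ψ⁺ = ψ(ψ⁻)⁻¹ comes out even (`exists_even_odd`). Square roots
exist and are unique because (φ * χ)(τ) equals φ(τ) + χ(τ) plus terms that involve only trees
smaller than τ (`mul_X_sub_congr`).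

All the algebra rests on one recursion, the cocycle property of grafting (`translate_graft`) for the
translations (φ ⊗ id) ∘ Δ.

The link with methods is `bSeries_mul`: composition of B-series is convolution of characters. Modulo
h^(n+2), a B-series with character χ is y + h ∑ χ([s]) (term of the forest s), the sum being over
forests s with at most n vertices. The functional s ↦ χ([s]) is not multiplicative, but on these
forests it is a finite combination ∑ c_ξ ξ of characters (`exists_combination_of_characters`), and
the forest sum of a character ξ is the expansion of f(B_ξ(y)). Up to this order every B-series is
thus y + h ∑ c_ξ f(B_ξ(y)), and substitution of another B-series for y is handled by induction on
the order. Since Ψ_{-h} has character ψ̄, the adjoint method has character ψ̄⁻¹; it is unique among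
all formal methods by `FormalMap.eq_of_comp_eq`. -/

noncomputable section

namespace BSeries

open MvPolynomial

/-! ## Non-planar trees as grafted forests -/

/-- Two finite families with the same multiset of values differ by a reindexing. -/
theorem exists_equiv_of_map_univ_eq {α β γ : Type*} [Fintype α] [Fintype β]
    {f : α → γ} {g : β → γ}
    (h : Finset.univ.val.map f = Finset.univ.val.map g) : ∃ e : α ≃ β, ∀ i, g (e i) = f i := by
  classical
  have hc : ∀ c, Nonempty ({a // f a = c} ≃ {b // g b = c}) := fun c => by
    refine ⟨Fintype.equivOfCardEq ?_⟩
    have := congrArg (Multiset.count c) h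
    simp only [Multiset.count_map] at this
    rw [Fintype.card_subtype, Fintype.card_subtype, Finset.card_def, Finset.card_def]
    simpa [Finset.filter_val, eq_comm] using this
  exact ⟨Equiv.ofFiberEquiv fun c => (hc c).some, fun i => Equiv.ofFiberEquiv_map _ _⟩

theorem Tree.mk_out (τ : Tree) : Tree.mk (Quotient.out τ) = τ := Quotient.out_eq τ

/-- Grafting a finite family of planar trees. -/
theorem Tree.node_map_mk {n : ℕ} (c : Fin n → PlanarTree) :
    Tree.node (Finset.univ.val.map fun i => Tree.mk (c i)) = Tree.mk (.node n c) := by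
  set s : Forest := Finset.univ.val.map fun i => Tree.mk (c i) with hs
  have h : (Finset.univ.val.map fun i => s.toList.get i) =
      Finset.univ.val.map fun i => Tree.mk (c i) := by
    rw [← hs, Fin.univ_val_map]
    conv_rhs => rw [← Multiset.coe_toList s]
    congr 1
    apply List.ext_get <;> simp
  obtain ⟨e, he⟩ := exists_equiv_of_map_univ_eq h
  refine Quotient.sound (s := PlanarTree.setoid) (PlanarTree.Iso.node e fun i => ?_)
  refine Quotient.exact (s := PlanarTree.setoid) ?_
  exact (Tree.mk_out _).trans (he i).symm

theorem Tree.node_map_univ {n : ℕ} (g : Fin n → Tree) :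
    Tree.node (Finset.univ.val.map g) = Tree.mk (.node n fun i => Quotient.out (g i)) := by
  rw [← Tree.node_map_mk]
  simp only [Tree.mk_out]

/-- Induction over non-planar trees. -/
theorem Tree.induction {P : Tree → Prop} (h : ∀ s : Forest, (∀ t ∈ s, P t) → P (Tree.node s))
    (τ : Tree) : P τ := by
  have key : ∀ t : PlanarTree, P (Tree.mk t) := by
    intro t
    induction t with
    | node n c ih =>
      rw [← Tree.node_map_mk]
      refine h _ fun t ht => ?_
      obtain ⟨i, -, rfl⟩ := Multiset.mem_map.1 ht
      exact ih i
  rw [← Tree.mk_out τ]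
  exact key _

/-- The forest of the subtrees at the root. -/
def Tree.children : Tree → Forest := Tree.para fun s => s.map Prod.fst

@[simp]
theorem Tree.children_node (s : Forest) : (Tree.node s).children = s := by
  simp [Tree.children, Tree.para_node]

@[simp]
theorem Tree.node_children (τ : Tree) : Tree.node τ.children = τ := by
  induction τ using Tree.induction with
  | h s _ => rw [Tree.children_node]

theorem Tree.node_injective : Function.Injective Tree.node :=
  Function.LeftInverse.injective Tree.children_node

/-- The number of vertices of a forest. -/
def weight (s : Forest) : ℕ := (s.map Tree.size).sum

@[simp] theorem weight_zero : weight 0 = 0 := rfl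

@[simp] theorem weight_cons (t : Tree) (s : Forest) : weight (t ::ₘ s) = t.size + weight s := by
  simp [weight]

@[simp] theorem weight_add (s t : Forest) : weight (s + t) = weight s + weight t := by
  simp [weight]

theorem Tree.size_node (s : Forest) : (Tree.node s).size = 1 + weight s := by
  unfold Tree.size
  rw [Tree.para_node, Multiset.map_map]
  rfl

theorem Tree.size_pos (τ : Tree) : 0 < τ.size := by
  rw [← Tree.node_children τ, Tree.size_node]
  omega

theorem Tree.symm_node (s : Forest) : (Tree.node s).symm =
    (∏ τ ∈ s.toFinset, (s.count τ).factorial) * (s.map Tree.symm).prod := by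
  unfold Tree.symm
  rw [Tree.para_node, Multiset.map_map, Multiset.map_map]
  simp only [Function.comp_def, Multiset.map_id']

/-! ## Grafting as a linear operator -/

@[simp] theorem ofForest_zero : ofForest 0 = 1 := rfl

@[simp] theorem ofForest_cons (t : Tree) (s : Forest) :
    ofForest (t ::ₘ s) = X t * ofForest s := by simp [ofForest]

@[simp] theorem ofForest_singleton (t : Tree) : ofForest {t} = X t := by simp [ofForest]

@[simp] theorem ofForest_add (s t : Forest) :
    ofForest (s + t) = ofForest s * ofForest t := by simp [ofForest]

theorem ofForest_sum (m : Multiset Forest) : ofForest m.sum = (m.map ofForest).prod := by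
  induction m using Multiset.induction_on with
  | empty => simp
  | cons a m ih => simp [ih]

theorem monomial_eq_ofForest (d : Tree →₀ ℕ) :
    (monomial d (1 : ℝ) : H) = ofForest (Finsupp.toMultiset d) := by
  induction d using Finsupp.induction with
  | zero => rfl
  | single_add a n f _ _ ih =>
    rw [map_add, ofForest_add, ← ih, ← mul_one (1 : ℝ), ← monomial_mul, mul_one,
      Finsupp.toMultiset_single]
    congr 1
    rw [ofForest, Multiset.map_nsmul, Multiset.prod_nsmul, Multiset.map_singleton,
      Multiset.prod_singleton, X_pow_eq_monomial]

theorem ofForest_eq_monomial (s : Forest) :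
    ofForest s = monomial (Multiset.toFinsupp s) (1 : ℝ) := by
  rw [monomial_eq_ofForest, Multiset.toFinsupp_toMultiset]

/-- Linear maps on `H` are determined by their values on forests. -/
theorem linearMap_ext {M : Type*} [AddCommMonoid M] [Module ℝ M] {f g : H →ₗ[ℝ] M}
    (h : ∀ s, f (ofForest s) = g (ofForest s)) : f = g := by
  refine (basisMonomials Tree ℝ).ext fun d => ?_
  rw [coe_basisMonomials]
  simpa only [monomial_eq_ofForest] using h _

/-- The linear operator that grafts the trees of a forest to a new root. -/
def graft : H →ₗ[ℝ] H :=
  (basisMonomials Tree ℝ).constr ℝ fun d => X (Tree.node (Finsupp.toMultiset d))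

@[simp]
theorem graft_ofForest (s : Forest) : graft (ofForest s) = X (Tree.node s) := by
  rw [ofForest_eq_monomial]
  have := (basisMonomials Tree ℝ).constr_basis ℝ
    (fun d => (X (Tree.node (Finsupp.toMultiset d)) : H)) (Multiset.toFinsupp s)
  rw [coe_basisMonomials] at this
  rw [graft, this, Multiset.toFinsupp_toMultiset]

theorem map_ofForest {A : Type*} [CommSemiring A] [Algebra ℝ A] (φ : H →ₐ[ℝ] A) (s : Forest) :
    φ (ofForest s) = (s.map fun t => φ (X t)).prod := by
  rw [ofForest, map_multiset_prod, Multiset.map_map]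
  rfl

/-! ## Admissible cuts and convolution -/

/-- The distributive law: expanding a product of sums amounts to choosing one summand from each
factor. -/
theorem sum_sections_prod {β R : Type*} [CommSemiring R] (v : β → R)
    (s : Multiset (Multiset β)) :
    ((Multiset.Sections s).map fun p => (p.map v).prod).sum =
      (s.map fun m => (m.map v).sum).prod := by
  induction s using Multiset.induction_on with
  | empty => simp
  | cons m s ih =>
    simp only [Multiset.sections_cons, Multiset.map_bind, Multiset.sum_bind, Multiset.map_map,
      Function.comp_def, Multiset.map_cons, Multiset.prod_cons, Multiset.sum_map_mul_left, ih,
      Multiset.sum_map_mul_right]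

/-- Sums over cuts of a grafted forest that are chosen independently in the subtrees. -/
theorem sum_sections_graft (φ : Character) (s : Multiset (Multiset (Forest × Forest))) :
    (((Multiset.Sections s).map fun p =>
      ((p.map Prod.fst).sum, Tree.node (p.map Prod.snd).sum)).map fun c =>
        C (φ (ofForest c.1)) * X c.2).sum =
      graft (s.map fun m => (m.map fun c => C (φ (ofForest c.1)) * ofForest c.2).sum).prod := by
  rw [← sum_sections_prod, map_multiset_sum, Multiset.map_map, Multiset.map_map]
  congr 1
  refine Multiset.map_congr rfl fun p _ => ?_
  simp only [Function.comp_def, Multiset.prod_map_mul]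
  rw [← graft_ofForest, ofForest_sum, ofForest_sum, map_multiset_prod, ← smul_eq_C_mul,
    ← map_smul, smul_eq_C_mul, map_multiset_prod]
  simp only [Multiset.map_map, Function.comp_def]

/-- The sum over the non-total admissible cuts, with the pruned part evaluated by `φ`. -/
def prune (φ : Character) (τ : Tree) : H :=
  (τ.admCuts.map fun c => C (φ (ofForest c.1)) * X c.2).sum

/-- The right translation `(φ ⊗ id) ∘ Δ`. -/
def translate (φ : Character) : H →ₐ[ℝ] H :=
  aeval fun τ => C (φ (X τ)) + prune φ τ

theorem translate_X (φ : Character) (τ : Tree) :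
    translate φ (X τ) = C (φ (X τ)) + prune φ τ := by simp [translate]

theorem Character.map_C (χ : Character) (r : ℝ) : χ (C r) = r := by
  rw [← algebraMap_eq, AlgHom.commutes]
  rfl

/-- Reduces the group laws for convolution to identities between algebra endomorphisms of `H`. -/
theorem conv_eq_comp (φ χ : Character) : φ.conv χ = χ.comp (translate φ) := by
  refine algHom_ext fun τ => ?_
  simp [Character.conv, coproduct, translate_X, prune, map_multiset_sum, Multiset.map_map,
    Function.comp_def]

/-- Cuts are chosen independently in the subtrees t of the root. Severing the edge to t contributes
φ(t), keeping it contributes `prune φ t`, together `translate φ (X t)`. -/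
theorem prune_node (φ : Character) (s : Forest) :
    prune φ (Tree.node s) = graft (translate φ (ofForest s)) := by
  unfold prune Tree.admCuts
  rw [Tree.para_node, sum_sections_graft, map_ofForest]
  congr 2
  rw [Multiset.map_map, Multiset.map_map]
  refine Multiset.map_congr rfl fun t _ => ?_
  simp only [Function.comp_def, Multiset.map_cons, Multiset.sum_cons, Multiset.map_map,
    ofForest_singleton, ofForest_zero, mul_one, translate_X]
  rfl

/-- The Hochschild cocycle property Δ B₊ = B₊ ⊗ 1 + (id ⊗ B₊) Δ, with φ applied to the left factor:
a cut of a grafted forest is either total or a cut of the forest below the root. -/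
theorem translate_graft (φ : Character) (p : H) :
    translate φ (graft p) = C (φ (graft p)) + graft (translate φ p) := by
  have : (translate φ).toLinearMap ∘ₗ graft =
      (Algebra.linearMap ℝ H) ∘ₗ φ.toLinearMap ∘ₗ graft + graft ∘ₗ (translate φ).toLinearMap := by
    refine linearMap_ext fun s => ?_
    simp [translate_X, prune_node, algebraMap_eq]
  simpa [algebraMap_eq] using LinearMap.congr_fun this p

/-- Two algebra maps on `H` that satisfy the same recursion on grafted forests are equal. -/
theorem algHom_ext_node {A : Type*} [CommSemiring A] [Algebra ℝ A] {f g : H →ₐ[ℝ] A}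
    (h : ∀ s, f (ofForest s) = g (ofForest s) → f (X (Tree.node s)) = g (X (Tree.node s))) :
    f = g := by
  refine algHom_ext fun τ => ?_
  induction τ using Tree.induction with
  | h s ih =>
    refine h s ?_
    rw [map_ofForest, map_ofForest, Multiset.map_congr rfl ih]

theorem conv_graft (φ χ : Character) (p : H) :
    φ.conv χ (graft p) = φ (graft p) + χ (graft (translate φ p)) := by
  rw [conv_eq_comp, AlgHom.comp_apply, translate_graft, map_add, Character.map_C]

/-- Coassociativity of Δ in terms of translations; both sides satisfy the recursion of
`translate_graft`. -/
theorem translate_conv (φ χ : Character) :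
    translate (φ.conv χ) = (translate χ).comp (translate φ) := by
  refine algHom_ext_node fun s hs => ?_
  simp only [AlgHom.comp_apply] at hs ⊢
  rw [← graft_ofForest, translate_graft, translate_graft, conv_graft, hs, map_add, map_add,
    translate_graft, add_assoc]
  congr 1
  rw [← algebraMap_eq, AlgHom.commutes]

/-- The unit of the Butcher group: the counit of `H`. -/
def counit : Character := aeval fun _ => 0

theorem counit_X (τ : Tree) : counit (X τ) = 0 := by simp [counit]

theorem translate_counit : translate counit = AlgHom.id ℝ H := by
  refine algHom_ext_node fun s hs => ?_
  rw [AlgHom.id_apply] at hs ⊢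
  rw [← graft_ofForest, translate_graft, hs, graft_ofForest, counit_X, map_zero, zero_add]

theorem conv_assoc (φ χ ξ : Character) : (φ.conv χ).conv ξ = φ.conv (χ.conv ξ) := by
  rw [conv_eq_comp _ ξ, translate_conv, conv_eq_comp φ, conv_eq_comp χ, AlgHom.comp_assoc]

theorem counit_conv (φ : Character) : counit.conv φ = φ := by
  rw [conv_eq_comp, translate_counit, AlgHom.comp_id]

theorem conv_counit (φ : Character) : φ.conv counit = φ := by
  refine algHom_ext_node fun s _ => ?_
  rw [← graft_ofForest, conv_graft]
  suffices h : counit.toLinearMap ∘ₗ graft = 0 by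
    have := LinearMap.congr_fun h (translate φ (ofForest s))
    simp only [LinearMap.comp_apply, AlgHom.toLinearMap_apply, LinearMap.zero_apply] at this
    rw [this, add_zero]
  refine linearMap_ext fun s => ?_
  simp [counit_X]

/-! ## The antipode -/

/-- The signed sum over all cuts, with the components without the root evaluated by `ζ`. -/
def signedCuts (ζ : Character) (τ : Tree) : H :=
  (τ.allCuts.map fun c => C ((-1) ^ Multiset.card c.1 * ζ (ofForest c.1)) * X c.2).sum

theorem inv_X (ζ : Character) (τ : Tree) : ζ.inv (X τ) = -ζ (signedCuts ζ τ) := by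
  simp only [Character.inv, antipode, signedCuts, AlgHom.comp_apply, aeval_X, map_multiset_sum,
    Multiset.map_map, Function.comp_def, map_mul, map_pow, map_neg, map_one, Character.map_C]
  rw [← Multiset.sum_map_neg]
  congr 1
  refine Multiset.map_congr rfl fun c _ => ?_
  ring

/-- The character `s ↦ (-1)^(number of trees of s) ζ(s)`. -/
def signed (ζ : Character) : Character := aeval fun τ => -ζ (X τ)

/-- Absorbing the sign of a cut into a character allows `sum_sections_graft` to be used for the
antipode. -/
theorem signed_ofForest (ζ : Character) (s : Forest) :
    signed ζ (ofForest s) = (-1) ^ Multiset.card s * ζ (ofForest s) := by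
  induction s using Multiset.induction_on with
  | empty => simp
  | cons t s ih =>
    rw [ofForest_cons, map_mul, map_mul, ih, Multiset.card_cons]
    simp only [signed, aeval_X]
    ring

theorem signedCuts_node (ζ : Character) (s : Forest) :
    signedCuts ζ (Tree.node s) =
      graft (s.map fun t => C (ζ.inv (X t)) + signedCuts ζ t).prod := by
  have hX : ∀ t, signed ζ (X t) = -ζ (X t) := fun t => by simp [signed]
  simp only [inv_X, signedCuts, ← signed_ofForest]
  conv_lhs => unfold Tree.allCuts
  rw [Tree.para_node, sum_sections_graft]
  congr 2
  rw [Multiset.map_map, Multiset.map_map]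
  refine Multiset.map_congr rfl fun t _ => ?_
  simp only [Function.comp_def, Multiset.map_add, Multiset.sum_add, Multiset.map_map,
    ofForest_singleton, ofForest_zero, mul_one, ofForest_add]
  congr 1
  rw [map_multiset_sum, Multiset.map_map, ← Multiset.sum_map_neg, map_multiset_sum,
    Multiset.map_map]
  congr 1
  refine Multiset.map_congr rfl fun c _ => ?_
  simp [hX]

/-- Both sides satisfy the same recursion on grafted forests. This identifies the sum over all cuts
with a sum over admissible cuts weighted by ζ ∘ S, which makes ζ ∘ S a left inverse of ζ. -/
theorem signedCuts_eq_prune (ζ : Character) (τ : Tree) :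
    signedCuts ζ τ = prune ζ.inv τ := by
  induction τ using Tree.induction with
  | h s ih =>
    rw [signedCuts_node, prune_node, map_ofForest]
    congr 2
    refine Multiset.map_congr rfl fun t ht => ?_
    rw [ih t ht, translate_X]

theorem inv_conv (ζ : Character) : ζ.inv.conv ζ = counit := by
  refine algHom_ext fun τ => ?_
  rw [conv_eq_comp, AlgHom.comp_apply, translate_X, ← signedCuts_eq_prune, map_add,
    Character.map_C, inv_X, counit_X, neg_add_cancel]

/-- The Butcher group. -/
instance : Group Character where
  mul := Character.conv
  one := counit
  inv := Character.inv
  mul_assoc := conv_assoc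
  one_mul := counit_conv
  mul_one := conv_counit
  inv_mul_cancel := inv_conv

theorem conv_eq_mul (φ χ : Character) : φ.conv χ = φ * χ := rfl

theorem inv_eq_inv (φ : Character) : φ.inv = φ⁻¹ := rfl

theorem one_eq_counit : (1 : Character) = counit := rfl

/-! ## The canonical involution -/

theorem involution_X (τ : Tree) : involution (X τ) = (-1) ^ τ.size * X τ := by
  simp [involution]

theorem involution_ofForest (s : Forest) :
    involution (ofForest s) = (-1) ^ weight s * ofForest s := by
  induction s using Multiset.induction_on with
  | empty => simp
  | cons t s ih => rw [ofForest_cons, map_mul, ih, involution_X, weight_cons]; ring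

/-- The sign comes from the one vertex that grafting adds. -/
theorem involution_graft (p : H) : involution (graft p) = -graft (involution p) := by
  have : involution.toLinearMap ∘ₗ graft = -(graft ∘ₗ involution.toLinearMap) := by
    refine linearMap_ext fun s => ?_
    have h : ((-1 : H) ^ weight s) = C ((-1 : ℝ) ^ weight s) := by simp
    simp only [LinearMap.comp_apply, AlgHom.toLinearMap_apply, LinearMap.neg_apply,
      involution_ofForest, graft_ofForest, involution_X]
    rw [Tree.size_node, pow_add, h, ← smul_eq_C_mul, map_smul, graft_ofForest, smul_eq_C_mul]
    ring
  simpa using LinearMap.congr_fun this p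

theorem involution_involution (p : H) : involution (involution p) = p := by
  have : involution.comp involution = AlgHom.id ℝ H := by
    refine algHom_ext fun τ => ?_
    rw [AlgHom.comp_apply, involution_X, map_mul, involution_X, AlgHom.id_apply, map_pow, map_neg,
      map_one, ← mul_assoc, ← mul_pow]
    simp
  exact DFunLike.congr_fun this p

theorem translate_bar (φ : Character) :
    translate φ.bar = (involution.comp (translate φ)).comp involution := by
  refine algHom_ext_node fun s hs => ?_
  simp only [AlgHom.comp_apply] at hs ⊢
  rw [← graft_ofForest, translate_graft, hs, involution_graft, map_neg, map_neg, translate_graft,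
    map_add, involution_graft, ← algebraMap_eq, AlgHom.commutes]
  simp only [Character.bar, AlgHom.comp_apply, involution_graft, map_neg]
  ring

theorem bar_mul (φ χ : Character) : (φ * χ).bar = φ.bar * χ.bar := by
  rw [← conv_eq_mul, ← conv_eq_mul, conv_eq_comp, conv_eq_comp, translate_bar]
  refine AlgHom.ext fun p => ?_
  simp [Character.bar, involution_involution]

theorem bar_bar (φ : Character) : φ.bar.bar = φ := by
  refine AlgHom.ext fun p => ?_
  simp [Character.bar, involution_involution]

/-- `ζ ↦ ζ̄` as an automorphism of the Butcher group. -/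
def barHom : Character →* Character := MonoidHom.mk' Character.bar bar_mul

theorem bar_inv (φ : Character) : φ⁻¹.bar = φ.bar⁻¹ := map_inv barHom φ

theorem adjoint_eq (φ : Character) : φ.adjoint = φ.bar⁻¹ := by
  rw [← bar_inv, ← inv_eq_inv]
  refine algHom_ext fun τ => ?_
  simp [Character.adjoint, Character.bar, Character.inv, involution_X]

theorem bar_X (φ : Character) (τ : Tree) : φ.bar (X τ) = (-1) ^ τ.size * φ (X τ) := by
  simp [Character.bar, involution_X]

/-! ## Triangularity of the convolution and square roots -/

/-- The span of the forests with fewer than `n` vertices. -/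
def lowerForests (n : ℕ) : Submodule ℝ H := Submodule.span ℝ (ofForest '' {s | weight s < n})

theorem ofForest_mem_lowerForests {s : Forest} {n : ℕ} (h : weight s < n) :
    ofForest s ∈ lowerForests n := Submodule.subset_span ⟨s, h, rfl⟩

theorem lowerForests_mono {m n : ℕ} (h : m ≤ n) : lowerForests m ≤ lowerForests n :=
  Submodule.span_mono (Set.image_mono fun _ hs => lt_of_lt_of_le hs h)

/-- The index `n + 1` encodes weight at most n: a strict and a non-strict bound add up to a strict
one. -/
theorem mul_mem_lowerForests {m n : ℕ} {p q : H} (hp : p ∈ lowerForests m)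
    (hq : q ∈ lowerForests (n + 1)) : p * q ∈ lowerForests (m + n) := by
  have h := Submodule.mul_mem_mul hp hq
  rw [lowerForests, lowerForests, Submodule.span_mul_span] at h
  refine Submodule.span_le.2 ?_ h
  rintro _ ⟨_, ⟨s, hs, rfl⟩, _, ⟨t, ht, rfl⟩, rfl⟩
  simp only [Set.mem_ofPred_eq] at hs ht
  change ofForest s * ofForest t ∈ _
  rw [← ofForest_add]
  exact ofForest_mem_lowerForests (by rw [weight_add]; omega)

theorem graft_mem_lowerForests {n : ℕ} {p : H} (hp : p ∈ lowerForests n) :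
    graft p ∈ lowerForests (n + 1) := by
  have : lowerForests n ≤ (lowerForests (n + 1)).comap graft := by
    refine Submodule.span_le.2 ?_
    rintro _ ⟨s, hs, rfl⟩
    simp only [Set.mem_ofPred_eq] at hs
    change graft (ofForest s) ∈ lowerForests (n + 1)
    rw [graft_ofForest, ← ofForest_singleton]
    refine ofForest_mem_lowerForests ?_
    simp only [weight, Multiset.map_singleton, Multiset.sum_singleton, Tree.size_node]
    simp only [weight] at hs
    omega
  exact this hp

theorem translate_ofForest_sub_mem_of_forall (φ : Character) (s : Forest)
    (h : ∀ t ∈ s, translate φ (X t) - X t ∈ lowerForests t.size) :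
    translate φ (ofForest s) - ofForest s ∈ lowerForests (weight s) := by
  induction s using Multiset.induction_on with
  | empty => simp
  | cons t s ih =>
    have hs := ih fun u hu => h u (Multiset.mem_cons_of_mem hu)
    have ht := h t (Multiset.mem_cons_self t s)
    have hs' : translate φ (ofForest s) ∈ lowerForests (weight s + 1) := by
      rw [← sub_add_cancel (translate φ (ofForest s)) (ofForest s)]
      exact add_mem (lowerForests_mono (Nat.le_succ _) hs)
        (ofForest_mem_lowerForests (Nat.lt_succ_self _))
    have ht' : (X t : H) ∈ lowerForests (t.size + 1) := by
      rw [← ofForest_singleton]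
      exact ofForest_mem_lowerForests (by simp [weight])
    rw [ofForest_cons, map_mul, weight_cons]
    have e : translate φ (X t) * translate φ (ofForest s) - X t * ofForest s =
        (translate φ (X t) - X t) * translate φ (ofForest s) +
          (translate φ (ofForest s) - ofForest s) * X t := by ring
    rw [e]
    refine add_mem (mul_mem_lowerForests ht hs') ?_
    rw [add_comm t.size]
    exact mul_mem_lowerForests hs ht'

/-- Translations are unipotent for the filtration by number of vertices: the empty cut returns the
tree, and every other cut removes at least one vertex. -/
theorem translate_X_sub_mem (φ : Character) (τ : Tree) :
    translate φ (X τ) - X τ ∈ lowerForests τ.size := by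
  induction τ using Tree.induction with
  | h s ih =>
    have h := translate_ofForest_sub_mem_of_forall φ s ih
    rw [← graft_ofForest, translate_graft, add_sub_assoc, ← map_sub, Tree.size_node, add_comm 1]
    refine add_mem ?_ (graft_mem_lowerForests h)
    -- The constant φ(τ) is a multiple of the empty forest, of weight 0.
    rw [← mul_one (C _), ← smul_eq_C_mul, ← ofForest_zero]
    exact Submodule.smul_mem _ _ (ofForest_mem_lowerForests (by simp))

theorem translate_ofForest_sub_mem (φ : Character) (s : Forest) :
    translate φ (ofForest s) - ofForest s ∈ lowerForests (weight s) :=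
  translate_ofForest_sub_mem_of_forall φ s fun t _ => translate_X_sub_mem φ t

theorem translate_ofForest_mem (φ : Character) (s : Forest) :
    translate φ (ofForest s) ∈ lowerForests (weight s + 1) := by
  rw [← sub_add_cancel (translate φ (ofForest s)) (ofForest s)]
  exact add_mem (lowerForests_mono (Nat.le_succ _) (translate_ofForest_sub_mem φ s))
    (ofForest_mem_lowerForests (Nat.lt_succ_self _))

theorem size_le_weight {t : Tree} {s : Forest} (h : t ∈ s) : t.size ≤ weight s :=
  Multiset.single_le_sum (fun _ _ => Nat.zero_le _) _ (Multiset.mem_map_of_mem _ h)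

theorem translate_ofForest_congr {φ φ' : Character} {n : ℕ}
    (h : ∀ t : Tree, t.size ≤ n → φ (X t) = φ' (X t)) {s : Forest} (hs : weight s ≤ n) :
    translate φ (ofForest s) = translate φ' (ofForest s) := by
  have key : ∀ t : Tree, t.size ≤ n → translate φ (X t) = translate φ' (X t) := by
    intro t
    induction t using Tree.induction with
    | h u ih =>
      intro hu
      rw [Tree.size_node] at hu
      have : translate φ (ofForest u) = translate φ' (ofForest u) := by
        rw [map_ofForest, map_ofForest]
        refine congrArg Multiset.prod (Multiset.map_congr rfl fun t ht => ih t ht ?_)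
        have := size_le_weight ht
        omega
      rw [← graft_ofForest, translate_graft, translate_graft, this, graft_ofForest,
        h _ (by rw [Tree.size_node]; omega)]
  rw [map_ofForest, map_ofForest]
  exact congrArg Multiset.prod
    (Multiset.map_congr rfl fun t ht => key t ((size_le_weight ht).trans hs))

theorem apply_graft_congr {χ χ' : Character} {n : ℕ}
    (h : ∀ t : Tree, t.size ≤ n → χ (X t) = χ' (X t)) {p : H} (hp : p ∈ lowerForests n) :
    χ (graft p) = χ' (graft p) := by
  have : lowerForests n ≤
      LinearMap.eqLocus (χ.toLinearMap ∘ₗ graft) (χ'.toLinearMap ∘ₗ graft) := by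
    refine Submodule.span_le.2 ?_
    rintro _ ⟨s, hs, rfl⟩
    simp only [Set.mem_ofPred_eq] at hs
    simp only [SetLike.mem_coe, LinearMap.mem_eqLocus, LinearMap.comp_apply,
      AlgHom.toLinearMap_apply, graft_ofForest]
    exact h _ (by rw [Tree.size_node]; omega)
  exact this hp

/-- The convolution is the sum up to terms that depend on smaller trees only. -/
theorem mul_X_sub_congr {φ φ' χ χ' : Character} {τ : Tree}
    (hφ : ∀ t : Tree, t.size < τ.size → φ (X t) = φ' (X t))
    (hχ : ∀ t : Tree, t.size < τ.size → χ (X t) = χ' (X t)) :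
    (φ * χ) (X τ) - φ (X τ) - χ (X τ) = (φ' * χ') (X τ) - φ' (X τ) - χ' (X τ) := by
  obtain ⟨s, rfl⟩ : ∃ s, Tree.node s = τ := ⟨_, Tree.node_children τ⟩
  rw [Tree.size_node] at hφ hχ
  -- Here φ is evaluated only on trees with at most `weight s` = |τ| - 1 vertices, and the argument
  -- of `graft` lies in `lowerForests (weight s)`, so that χ too sees only trees smaller than τ.
  have e : ∀ φ χ : Character, (φ * χ) (X (Tree.node s)) - φ (X (Tree.node s)) -
      χ (X (Tree.node s)) = χ (graft (translate φ (ofForest s) - ofForest s)) := by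
    intro φ χ
    rw [← conv_eq_mul, ← graft_ofForest, conv_graft, map_sub, map_sub]
    ring
  rw [e, e, translate_ofForest_congr (φ := φ) (φ' := φ') (n := weight s)
    (fun t ht => hφ t (by omega)) le_rfl]
  exact apply_graft_congr (fun t ht => hχ t (by omega)) (translate_ofForest_sub_mem φ' s)

/-- The square at τ is twice the value at τ plus terms from smaller trees, so it determines the
values inductively. -/
theorem eq_of_mul_self_eq {φ χ : Character} (h : φ * φ = χ * χ) : φ = χ := by
  refine algHom_ext fun τ => ?_
  induction hn : τ.size using Nat.strong_induction_on generalizing τ with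
  | _ n ih =>
    subst hn
    have hlt : ∀ t : Tree, t.size < τ.size → φ (X t) = χ (X t) := fun t ht => ih _ ht t rfl
    have := mul_X_sub_congr hlt hlt
    rw [h] at this
    linarith

/-- Successive approximations of the square root of `a`. -/
def sqrtApprox (a : Character) : ℕ → Character
  | 0 => 1
  | n + 1 => aeval fun τ =>
      sqrtApprox a n (X τ) + (a (X τ) - (sqrtApprox a n * sqrtApprox a n) (X τ)) / 2

/-- The defect vanishes on trees with at most n vertices, so the next step leaves these alone. On
trees with n + 1 vertices a correction δ changes the square by 2δ, hence the division by 2. -/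
theorem sqrtApprox_mul_self (a : Character) (n : ℕ) (τ : Tree) (h : τ.size ≤ n) :
    (sqrtApprox a n * sqrtApprox a n) (X τ) = a (X τ) := by
  induction n generalizing τ with
  | zero => exact absurd h (by have := τ.size_pos; omega)
  | succ n ih =>
    have e : ∀ t, sqrtApprox a (n + 1) (X t) = sqrtApprox a n (X t) +
        (a (X t) - (sqrtApprox a n * sqrtApprox a n) (X t)) / 2 := fun t => by
      rw [sqrtApprox, aeval_X]
    have hlt : ∀ t : Tree, t.size < τ.size →
        sqrtApprox a (n + 1) (X t) = sqrtApprox a n (X t) := fun t ht => by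
      rw [e, ih t (by omega)]
      simp
    have := mul_X_sub_congr hlt hlt
    have := e τ
    linarith

theorem sqrtApprox_stable (a : Character) {m n : ℕ} (h : m ≤ n) {τ : Tree} (hτ : τ.size ≤ m) :
    sqrtApprox a n (X τ) = sqrtApprox a m (X τ) := by
  induction n, h using Nat.le_induction with
  | base => rfl
  | succ n hn ih =>
    rw [sqrtApprox, aeval_X, sqrtApprox_mul_self a n τ (hτ.trans hn), ih]
    simp

/-- The approximations are stationary on each tree from step |τ| on; their diagonal is the root. -/
theorem exists_mul_self_eq (a : Character) : ∃ φ : Character, φ * φ = a := by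
  refine ⟨aeval fun τ => sqrtApprox a τ.size (X τ), algHom_ext fun τ => ?_⟩
  set φ : Character := aeval fun τ => sqrtApprox a τ.size (X τ) with hφ
  have h : ∀ t : Tree, t.size ≤ τ.size → φ (X t) = sqrtApprox a τ.size (X t) := fun t ht => by
    rw [hφ, aeval_X]
    exact (sqrtApprox_stable a ht le_rfl).symm
  have := mul_X_sub_congr (τ := τ) (fun t ht => h t ht.le) (fun t ht => h t ht.le)
  rw [sqrtApprox_mul_self a τ.size τ le_rfl, h τ le_rfl] at this
  linarith

/-- The factorisation of a character into an even and an odd one. -/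
theorem exists_even_odd (ψ : Character) : ∃ ψm ψp : Character,
    ψm.IsOdd ∧ ψp.IsEven ∧ ψ = ψp * ψm ∧ ψm * ψm = ψ.adjoint * ψ := by
  obtain ⟨φ, hφ⟩ := exists_mul_self_eq (ψ.adjoint * ψ)
  rw [adjoint_eq] at hφ
  have hodd : φ.bar = φ⁻¹ := by
    -- Both squares equal ψ⁻¹ψ̄, the inverse of φ² = ψ̄⁻¹ψ.
    refine eq_of_mul_self_eq ?_
    rw [← bar_mul, hφ, bar_mul, bar_inv, bar_bar, ← mul_inv_rev, hφ, mul_inv_rev, inv_inv]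
  refine ⟨φ, ψ * φ⁻¹, hodd, ?_, by simp, by rw [hφ, adjoint_eq]⟩
  -- Evenness of ψφ⁻¹ reduces to ψ̄φ² = ψ.
  rw [Character.IsEven, bar_mul, bar_inv, hodd, inv_inv, eq_mul_inv_iff_mul_eq, mul_assoc, hφ,
    mul_inv_cancel_left]

/-! ## Characters span the dual of `H` in each degree -/

/-- Characters separate the elements of `H`. -/
theorem eq_zero_of_forall_character {p : H} (h : ∀ χ : Character, χ p = 0) : p = 0 :=
  -- Characters are the point evaluations, and a polynomial over the infinite field ℝ that vanishes
  -- at every point is zero.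
  MvPolynomial.funext fun x => by
    rw [map_zero, ← MvPolynomial.coe_aeval_eq_eval]
    exact h (aeval x)

theorem finite_treesLE (n : ℕ) : {τ : Tree | τ.size ≤ n}.Finite := by
  have : {τ : Tree | τ.size ≤ n} = ⋃ k ∈ Set.Iic n, {τ : Tree | τ.size = k} := by
    ext τ
    simp
  rw [this]
  exact (Set.finite_Iic n).biUnion fun k _ => Tree.finite_size k

theorem finite_forestsLE (n : ℕ) : {s : Forest | weight s ≤ n}.Finite := by
  refine Set.Finite.of_finite_image (f := Tree.node) ?_ Tree.node_injective.injOn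
  refine (finite_treesLE (n + 1)).subset ?_
  rintro _ ⟨s, hs, rfl⟩
  simp only [Set.mem_ofPred_eq, Tree.size_node] at hs ⊢
  omega

/-- Every linear functional on `H` agrees with a linear combination of characters on the forests
with at most `n` vertices. -/
theorem exists_combination_of_characters (L : H →ₗ[ℝ] ℝ) (n : ℕ) :
    ∃ c : Character →₀ ℝ, ∀ p ∈ lowerForests (n + 1), L p = c.sum fun χ r => r * χ p := by
  set V := lowerForests (n + 1)
  have : FiniteDimensional ℝ V := by
    refine FiniteDimensional.span_of_finite ℝ (Set.Finite.image _ ?_)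
    simpa only [Nat.lt_succ_iff] using finite_forestsLE n
  let W : Submodule ℝ (Module.Dual ℝ V) :=
    Submodule.span ℝ (Set.range fun χ : Character => χ.toLinearMap ∘ₗ V.subtype)
  -- In finite dimension a subspace of the dual is the annihilator of its common kernel, which is
  -- trivial because characters separate points.
  have hW : W = ⊤ := by
    rw [← Subspace.dualCoannihilator_dualAnnihilator_eq (W := W)]
    have : W.dualCoannihilator = ⊥ := by
      refine (Submodule.eq_bot_iff _).2 fun v hv => ?_
      rw [Submodule.mem_dualCoannihilator] at hv
      refine Subtype.ext (eq_zero_of_forall_character fun χ => ?_)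
      exact hv _ (Submodule.subset_span ⟨χ, rfl⟩)
    rw [this, Submodule.dualAnnihilator_bot]
  have hL : L ∘ₗ V.subtype ∈ W := hW ▸ Submodule.mem_top
  obtain ⟨c, hc⟩ := (Finsupp.mem_span_range_iff_exists_finsupp).1 hL
  refine ⟨c, fun p hp => ?_⟩
  have := LinearMap.congr_fun hc ⟨p, hp⟩
  simp only [Finsupp.sum, LinearMap.sum_apply, LinearMap.smul_apply, LinearMap.comp_apply,
    Submodule.subtype_apply, AlgHom.toLinearMap_apply, smul_eq_mul] at this
  exact this.symm

open Filter Topology Asymptotics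

/-! ## Taylor expansion with locally uniform remainder -/

section Taylor

variable {E G : Type*} [NormedAddCommGroup E] [NormedSpace ℝ E] [NormedAddCommGroup G]
  [NormedSpace ℝ G]

theorem iteratedDeriv_line {f : E → G} (hf : ContDiff ℝ ∞ f) (x v : E) (k : ℕ) (t : ℝ) :
    iteratedDeriv k (fun t : ℝ => f (x + t • v)) t =
      iteratedFDeriv ℝ k f (x + t • v) fun _ => v := by
  have hg : ContDiff ℝ ∞ fun z => f (x + z) := hf.comp (contDiff_const.add contDiff_id)
  have := (ContinuousLinearMap.toSpanSingleton ℝ v).iteratedFDeriv_comp_right (i := k) hg t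
    (by exact_mod_cast le_top)
  rw [iteratedDeriv_eq_iteratedFDeriv]
  change iteratedFDeriv ℝ k ((fun z => f (x + z)) ∘ ContinuousLinearMap.toSpanSingleton ℝ v) t
    (fun _ => 1) = _
  rw [this]
  simp [iteratedFDeriv_comp_add_left]

/-- The base point varies along with the increment, because the expansion is later used at a base
point that moves with h. The bound on the next derivative over a ball is uniform, and by convexity
the ball contains the segment of expansion. -/
theorem taylor_isBigO {f : E → G} (hf : ContDiff ℝ ∞ f) (y : E) (n : ℕ) :
    (fun p : E × E => f (p.1 + p.2) -
      ∑ k ∈ Finset.range (n + 1), (k.factorial : ℝ)⁻¹ • iteratedFDeriv ℝ k f p.1 fun _ => p.2)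
      =O[𝓝 (y, 0)] fun p => ‖p.2‖ ^ (n + 1) := by
  have hcont : Continuous fun x => ‖iteratedFDeriv ℝ (n + 1) f x‖ :=
    (hf.continuous_iteratedFDeriv (by exact_mod_cast le_top)).norm
  obtain ⟨r, hr, hball⟩ := Metric.eventually_nhds_iff_ball.1
    (hcont.continuousAt.eventually_lt continuousAt_const (lt_add_one ‖iteratedFDeriv ℝ (n + 1) f y‖))
  set M := ‖iteratedFDeriv ℝ (n + 1) f y‖ + 1
  have h1 : ∀ᶠ p : E × E in 𝓝 (y, 0), p.1 ∈ Metric.ball y r :=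
    continuousAt_fst.eventually (Metric.ball_mem_nhds y hr)
  have h2 : ∀ᶠ p : E × E in 𝓝 (y, 0), p.1 + p.2 ∈ Metric.ball y r := by
    have : Tendsto (fun p : E × E => p.1 + p.2) (𝓝 (y, 0)) (𝓝 y) := by
      have : Continuous fun p : E × E => p.1 + p.2 := by fun_prop
      simpa using this.tendsto (y, (0 : E))
    exact this.eventually (Metric.ball_mem_nhds y hr)
  refine IsBigO.of_bound (M / n.factorial) ?_
  filter_upwards [h1, h2] with p hp1 hp2
  obtain ⟨x, v⟩ := p
  simp only at hp1 hp2 ⊢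
  have hg : ContDiff ℝ ∞ fun t : ℝ => f (x + t • v) :=
    hf.comp (contDiff_const.add (contDiff_id.smul contDiff_const))
  have hD : ∀ k : ℕ, ∀ t ∈ Set.Icc (0 : ℝ) 1,
      iteratedDerivWithin k (fun t : ℝ => f (x + t • v)) (Set.Icc 0 1) t =
        iteratedFDeriv ℝ k f (x + t • v) fun _ => v := by
    intro k t ht
    rw [iteratedDerivWithin_eq_iteratedDeriv (uniqueDiffOn_Icc zero_lt_one)
      (hg.of_le (by exact_mod_cast le_top)).contDiffAt ht, iteratedDeriv_line hf]
  have hseg : ∀ t ∈ Set.Icc (0 : ℝ) 1, x + t • v ∈ Metric.ball y r := fun t ht => by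
    have := (convex_ball y r).add_smul_sub_mem hp1 hp2 ht
    simpa using this
  have hC : ∀ t ∈ Set.Icc (0 : ℝ) 1,
      ‖iteratedDerivWithin (n + 1) (fun t : ℝ => f (x + t • v)) (Set.Icc 0 1) t‖ ≤
        M * ‖v‖ ^ (n + 1) := by
    intro t ht
    rw [hD _ t ht]
    refine (ContinuousMultilinearMap.le_opNorm _ _).trans ?_
    rw [Finset.prod_const, Finset.card_univ, Fintype.card_fin]
    exact mul_le_mul_of_nonneg_right (hball _ (hseg t ht)).le (by positivity)
  have := taylor_mean_remainder_bound (n := n) zero_le_one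
    (hg.of_le (by exact_mod_cast le_top)).contDiffOn (Set.right_mem_Icc.2 zero_le_one) hC
  rw [taylor_within_apply] at this
  simp only [hD _ 0 (Set.left_mem_Icc.2 zero_le_one)] at this
  simp only [one_smul, sub_zero, one_pow, mul_one, zero_smul, add_zero] at this
  refine this.trans (le_of_eq ?_)
  rw [norm_pow, norm_norm]
  ring

theorem taylor_curve_isBigO {u : ℝ → G} (hu : ContDiff ℝ ∞ u) (n : ℕ) :
    (fun h : ℝ => u h - ∑ k ∈ Finset.range (n + 1),
      h ^ k • (k.factorial : ℝ)⁻¹ • iteratedDeriv k u 0) =O[𝓝 0] fun h => h ^ (n + 1) := by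
  have ht : Tendsto (fun h : ℝ => ((0 : ℝ), h)) (𝓝 0) (𝓝 (0, 0)) :=
    (Continuous.prodMk_right (0 : ℝ)).tendsto 0
  have := (taylor_isBigO hu 0 n).comp_tendsto ht
  simp only [Function.comp_def, zero_add] at this
  refine (this.congr' (Eventually.of_forall fun h => ?_) EventuallyEq.rfl).trans ?_
  · refine congrArg (u h - ·) (Finset.sum_congr rfl fun k _ => ?_)
    rw [smul_comm, iteratedDeriv_eq_iteratedFDeriv]
    have := (iteratedFDeriv ℝ k u 0).map_smul_univ (fun _ => h) fun _ => (1 : ℝ)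
    simp only [smul_eq_mul, mul_one, Finset.prod_const, Finset.card_univ, Fintype.card_fin] at this
    rw [this]
  · refine IsBigO.of_bound 1 (Eventually.of_forall fun h => ?_)
    simp

theorem isBigO_pow_smul {α : Type*} {l : Filter α} {h : α → ℝ} (hh : Tendsto h l (𝓝 0))
    {g : α → G} (hg : g =O[l] fun _ => (1 : ℝ)) {m k : ℕ} (hmk : m ≤ k) :
    (fun a => h a ^ k • g a) =O[l] fun a => h a ^ m := by
  have := (isBigO_refl (fun a => h a ^ m) l).smul (((hh.pow (k - m)).isBigO_one ℝ).smul hg)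
  refine (this.congr_left fun a => ?_).congr_right fun a => by simp
  rw [smul_smul, ← pow_add, Nat.add_sub_cancel' hmk]

/-- A polynomial of degree at most `n` that vanishes to order `n + 1` is zero. -/
theorem coeff_eq_zero_of_isBigO {n : ℕ} {c : ℕ → G}
    (h : (fun t : ℝ => ∑ k ∈ Finset.range (n + 1), t ^ k • c k) =O[𝓝 0] fun t => t ^ (n + 1)) :
    ∀ k ≤ n, c k = 0 := by
  intro k
  induction k using Nat.strong_induction_on with
  | _ k ih =>
    intro hk
    have h1 : (fun t : ℝ => ∑ j ∈ Finset.range (n + 1), t ^ j • c j - t ^ k • c k) =O[𝓝 0]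
        fun t => t ^ (k + 1) := by
      have e : (fun t : ℝ => ∑ j ∈ Finset.range (n + 1), t ^ j • c j - t ^ k • c k) =
          fun t => ∑ j ∈ (Finset.range (n + 1)).erase k, t ^ j • c j := by
        funext t
        rw [← Finset.sum_erase_add _ _ (Finset.mem_range.2 (Nat.lt_succ_of_le hk)),
          add_sub_cancel_right]
      rw [e]
      refine IsBigO.fun_sum fun j hj => ?_
      rcases lt_or_gt_of_ne (Finset.ne_of_mem_erase hj) with hlt | hgt
      · rw [ih j hlt (by omega)]
        simp only [smul_zero]
        exact isBigO_zero (E' := G) (fun t : ℝ => t ^ (k + 1)) (𝓝 0)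
      · exact isBigO_pow_smul tendsto_id (isBigO_const_const (c j) one_ne_zero _) hgt
    have h2 : (fun t : ℝ => t ^ k • c k) =O[𝓝 0] fun t => t ^ (k + 1) := by
      have h3 : (fun t : ℝ => t ^ (n + 1)) =O[𝓝 0] fun t => t ^ (k + 1) := by
        simpa using isBigO_pow_smul (tendsto_id (α := ℝ) (x := 𝓝 0))
          (isBigO_const_const (1 : ℝ) one_ne_zero _) (show k + 1 ≤ n + 1 by omega)
      refine ((h.trans h3).sub h1).congr_left fun t => ?_
      rw [sub_sub_cancel]
    obtain ⟨C, hC⟩ := h2.bound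
    -- Division by |t|^k isolates the lowest remaining coefficient; t → 0 then kills it.
    have h4 : ∀ᶠ t : ℝ in 𝓝[≠] 0, ‖c k‖ ≤ C * ‖t‖ := by
      filter_upwards [hC.filter_mono nhdsWithin_le_nhds, self_mem_nhdsWithin] with t ht ht0
      have hpos : 0 < ‖t ^ k‖ := norm_pos_iff.2 (pow_ne_zero k ht0)
      rw [norm_smul, pow_succ, norm_mul] at ht
      refine le_of_mul_le_mul_left (ht.trans (le_of_eq ?_)) hpos
      ring
    have h5 : Tendsto (fun t : ℝ => C * ‖t‖) (𝓝[≠] 0) (𝓝 0) := by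
      have : Continuous fun t : ℝ => C * ‖t‖ := by fun_prop
      simpa using (this.tendsto 0).mono_left nhdsWithin_le_nhds
    exact norm_le_zero_iff.1 (ge_of_tendsto h5 h4)

end Taylor

/-! ## Elementary differentials and truncated B-series -/

/-- Splitting off the last argument replaces f by its derivative, whose target is a space of linear
maps; hence the induction runs over all target spaces `G`. -/
theorem contDiff_iteratedFDeriv_apply {E : Type} [NormedAddCommGroup E] [NormedSpace ℝ E] (n : ℕ) :
    ∀ {G : Type} [NormedAddCommGroup G] [NormedSpace ℝ G] {f : E → G}, ContDiff ℝ ∞ f →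
      ∀ {v : Fin n → E → E}, (∀ i, ContDiff ℝ ∞ (v i)) →
        ContDiff ℝ ∞ fun x => iteratedFDeriv ℝ n f x fun i => v i x := by
  induction n with
  | zero => intro G _ _ f hf v _; simpa using hf
  | succ n ih =>
    intro G _ _ f hf v hv
    simp only [iteratedFDeriv_succ_apply_right]
    refine ContDiff.clm_apply ?_ (hv _)
    exact ih (hf.fderiv_right (by simp)) fun i => hv i.castSucc

variable {N : ℕ}

theorem PlanarTree.contDiff_elemDiff (f : VectorField N) (t : PlanarTree) :
    ContDiff ℝ ∞ fun y => t.elemDiff f y := by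
  induction t with
  | node n c ih => exact contDiff_iteratedFDeriv_apply n f.smooth ih

theorem Tree.elemDiff_mk (f : VectorField N) (y : Space N) (t : PlanarTree) :
    (Tree.mk t).elemDiff f y = t.elemDiff f y := rfl

theorem Tree.contDiff_elemDiff (f : VectorField N) (τ : Tree) :
    ContDiff ℝ ∞ fun y => τ.elemDiff f y := by
  rw [← Tree.mk_out τ]
  exact PlanarTree.contDiff_elemDiff f _

theorem Tree.elemDiff_node_map (f : VectorField N) (y : Space N) {n : ℕ} (g : Fin n → Tree) :
    (Tree.node (Finset.univ.val.map g)).elemDiff f y =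
      iteratedFDeriv ℝ n f.toFun y fun i => (g i).elemDiff f y := by
  rw [Tree.node_map_univ, Tree.elemDiff_mk, PlanarTree.elemDiff]
  simp only [← Tree.elemDiff_mk, Tree.mk_out]

/-- The finite set of trees with at most `n` vertices. -/
def treesLE (n : ℕ) : Finset Tree := (finite_treesLE n).toFinset

/-- The finite set of forests with at most `n` vertices. -/
def forestsLE (n : ℕ) : Finset Forest := (finite_forestsLE n).toFinset

@[simp] theorem mem_treesLE {n : ℕ} {τ : Tree} : τ ∈ treesLE n ↔ τ.size ≤ n := by
  simp [treesLE]

@[simp] theorem mem_forestsLE {n : ℕ} {s : Forest} : s ∈ forestsLE n ↔ weight s ≤ n := by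
  simp [forestsLE]

@[simp] theorem mem_treesOfSize {n : ℕ} {τ : Tree} : τ ∈ treesOfSize n ↔ τ.size = n := by
  simp [treesOfSize]

/-- The B-series with coefficients `a`, without the term of the empty tree and truncated after
order `n`. -/
def truncSeries (f : VectorField N) (a : Tree → ℝ) (n : ℕ) (p : ℝ × Space N) : Space N :=
  ∑ τ ∈ treesLE n, p.1 ^ τ.size • ((τ.symm : ℝ)⁻¹ * a τ) • τ.elemDiff f p.2

/-- The term of the forest `s` in the expansion of `f` along a B-series. -/
def forestTerm (f : VectorField N) (a : Forest → ℝ) (p : ℝ × Space N) (s : Forest) : Space N :=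
  p.1 ^ weight s • (((Tree.node s).symm : ℝ)⁻¹ * a s) • (Tree.node s).elemDiff f p.2

/-- Removing the root matches trees with forests having one vertex less; the root supplies the
factor h. -/
theorem truncSeries_succ (f : VectorField N) (a : Tree → ℝ) (n : ℕ) (p : ℝ × Space N) :
    truncSeries f a (n + 1) p =
      p.1 • ∑ s ∈ forestsLE n, forestTerm f (fun s => a (Tree.node s)) p s := by
  rw [truncSeries, Finset.smul_sum]
  refine (Finset.sum_nbij Tree.node (fun s hs => ?_) Tree.node_injective.injOn (fun τ hτ => ?_)
    fun s _ => ?_).symm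
  · rw [mem_forestsLE] at hs
    rw [mem_treesLE, Tree.size_node]
    omega
  · refine ⟨τ.children, ?_, Tree.node_children τ⟩
    rw [SetLike.mem_coe, mem_treesLE, ← Tree.node_children τ, Tree.size_node] at hτ
    rw [SetLike.mem_coe, mem_forestsLE]
    omega
  · rw [forestTerm, smul_smul p.1, Tree.size_node, pow_add, pow_one]

/-- Grafting followed by the elementary differential, as a linear map on `H`. -/
def graftDiff (f : VectorField N) (y : Space N) : H →ₗ[ℝ] Space N :=
  (basisMonomials Tree ℝ).constr ℝ fun d => (Tree.node (Finsupp.toMultiset d)).elemDiff f y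

theorem graftDiff_ofForest (f : VectorField N) (y : Space N) (s : Forest) :
    graftDiff f y (ofForest s) = (Tree.node s).elemDiff f y := by
  rw [ofForest_eq_monomial]
  have := (basisMonomials Tree ℝ).constr_basis ℝ
    (fun d => (Tree.node (Finsupp.toMultiset d)).elemDiff f y) (Multiset.toFinsupp s)
  rw [coe_basisMonomials] at this
  rw [graftDiff, this, Multiset.toFinsupp_toMultiset]

theorem prod_smul_X (b : Tree → ℝ) (s : Forest) :
    (s.map fun τ => b τ • (X τ : H)).prod = (s.map b).prod • ofForest s := by
  induction s using Multiset.induction_on with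
  | empty => simp
  | cons t s ih =>
    rw [Multiset.map_cons, Multiset.prod_cons, ih, Multiset.map_cons, Multiset.prod_cons,
      ofForest_cons, smul_mul_smul_comm]

/-- Derivatives of `f` in the direction of a combination of elementary differentials. -/
theorem iteratedFDeriv_sum_elemDiff (f : VectorField N) (y : Space N) (A : Finset Tree)
    (b : Tree → ℝ) (k : ℕ) :
    (iteratedFDeriv ℝ k f.toFun y fun _ => ∑ τ ∈ A, b τ • τ.elemDiff f y) =
      graftDiff f y ((∑ τ ∈ A, b τ • (X τ : H)) ^ k) := by
  -- Expanding the multilinear form and the k-th power gives the same sum over maps `Fin k → Tree`.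
  -- The elementary differential depends only on the multiset of values of such a map, so it factors
  -- through the commutative algebra `H`.
  have h : (∑ τ ∈ A, b τ • (X τ : H)) ^ k =
      ∏ _i : Fin k, ∑ τ ∈ A, b τ • (X τ : H) := by simp
  rw [h, Finset.prod_univ_sum, map_sum, ContinuousMultilinearMap.map_sum_finset]
  refine Finset.sum_congr rfl fun g _ => ?_
  have e1 : ∏ i, b (g i) • (X (g i) : H) =
      ((Finset.univ.val.map g).map fun τ => b τ • (X τ : H)).prod := by
    rw [Multiset.map_map]
    rfl
  rw [e1, prod_smul_X, map_smul, graftDiff_ofForest, Tree.elemDiff_node_map,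
    ContinuousMultilinearMap.map_smul_univ, Multiset.map_map]
  rfl

/-- The multinomial count that turns the Taylor factor 1/k! into the multiplicity factorials of σ.
-/
theorem countPerms_mul (s : Forest) :
    s.countPerms * ∏ τ ∈ s.toFinset, (s.count τ).factorial = (Multiset.card s).factorial := by
  have := Nat.multinomial_spec s.toFinset fun τ => s.count τ
  rw [Multiset.toFinset_sum_count_eq] at this
  rw [← this, mul_comm]
  congr 1

theorem prod_coeff (φ : Character) (h : ℝ) (s : Forest) :
    (s.map fun τ => h ^ τ.size * ((τ.symm : ℝ)⁻¹ * φ (X τ))).prod =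
      h ^ weight s * (((s.map Tree.symm).prod : ℝ)⁻¹ * φ (ofForest s)) := by
  induction s using Multiset.induction_on with
  | empty => simp
  | cons t s ih =>
    rw [Multiset.map_cons, Multiset.prod_cons, ih, weight_cons, ofForest_cons, map_mul,
      Multiset.map_cons, Multiset.prod_cons, Nat.cast_mul, mul_inv]
    ring

/-- The `k`-th term of the Taylor expansion of `f` along a truncated B-series. -/
theorem taylor_term_truncSeries (f : VectorField N) (φ : Character) (n k : ℕ) (p : ℝ × Space N) :
    ((k.factorial : ℝ)⁻¹ • iteratedFDeriv ℝ k f.toFun p.2 fun _ =>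
      truncSeries f (fun τ => φ (X τ)) n p) =
      ∑ s ∈ (treesLE n).sym k, forestTerm f (fun s => φ (ofForest s)) p s.1 := by
  simp only [truncSeries, smul_smul]
  rw [iteratedFDeriv_sum_elemDiff f p.2 (treesLE n)
    (fun τ => p.1 ^ τ.size * ((τ.symm : ℝ)⁻¹ * φ (X τ))), Finset.sum_pow, map_sum, Finset.smul_sum]
  refine Finset.sum_congr rfl fun s _ => ?_
  have hcard : Multiset.card s.1 = k := s.2
  have hc := countPerms_mul s.1
  rw [hcard] at hc
  have hc' : (s.1.countPerms : ℝ) * ((∏ τ ∈ s.1.toFinset, (s.1.count τ).factorial : ℕ) : ℝ) =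
    k.factorial := by exact_mod_cast hc
  have hk : (k.factorial : ℝ) ≠ 0 := by exact_mod_cast k.factorial_ne_zero
  have hne : ((∏ τ ∈ s.1.toFinset, (s.1.count τ).factorial : ℕ) : ℝ) ≠ 0 := by
    intro h0
    rw [h0, mul_zero] at hc'
    exact hk hc'.symm
  have hcp : (k.factorial : ℝ)⁻¹ * s.1.countPerms =
      ((∏ τ ∈ s.1.toFinset, (s.1.count τ).factorial : ℕ) : ℝ)⁻¹ := by
    rw [inv_mul_eq_iff_eq_mul₀ hk, eq_mul_inv_iff_mul_eq₀ hne, hc']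
  rw [prod_smul_X, prod_coeff, ← nsmul_eq_mul, map_nsmul, map_smul, graftDiff_ofForest, forestTerm,
    Tree.symm_node, ← Nat.cast_smul_eq_nsmul ℝ, smul_smul, smul_smul, smul_smul, ← mul_assoc, hcp,
    Nat.cast_mul, mul_inv]
  congr 1
  ring

theorem continuous_smul_elemDiff (f : VectorField N) (r : ℝ) (τ : Tree) :
    Continuous fun p : ℝ × Space N => r • τ.elemDiff f p.2 := by
  have h : Continuous fun p : ℝ × Space N => τ.elemDiff f p.2 :=
    (Tree.contDiff_elemDiff f τ).continuous.comp continuous_snd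
  fun_prop

theorem forestTerm_isBigO (f : VectorField N) (a : Forest → ℝ) (y : Space N) {s : Forest} {m : ℕ}
    (hm : m ≤ weight s) :
    (fun p => forestTerm f a p s) =O[𝓝 ((0 : ℝ), y)] fun p => p.1 ^ m := by
  refine isBigO_pow_smul (continuous_fst.tendsto ((0 : ℝ), y)) ?_ hm
  exact ((continuous_smul_elemDiff f _ _).tendsto (0, y)).isBigO_one ℝ

theorem continuous_truncSeries (f : VectorField N) (a : Tree → ℝ) (n : ℕ) :
    Continuous (truncSeries f a n) := by
  refine continuous_finsetSum _ fun τ _ => ?_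
  exact (continuous_fst.pow _).smul (continuous_smul_elemDiff f _ τ)

theorem truncSeries_zero_left (f : VectorField N) (a : Tree → ℝ) (n : ℕ) (y : Space N) :
    truncSeries f a n (0, y) = 0 :=
  Finset.sum_eq_zero fun τ _ => by simp [τ.size_pos.ne']

theorem truncSeries_isBigO (f : VectorField N) (a : Tree → ℝ) (n : ℕ) (y : Space N) :
    truncSeries f a n =O[𝓝 ((0 : ℝ), y)] fun p => p.1 := by
  refine IsBigO.fun_sum fun τ _ => ?_
  simpa only [pow_one] using isBigO_pow_smul (continuous_fst.tendsto ((0 : ℝ), y))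
    (((continuous_smul_elemDiff f _ τ).tendsto (0, y)).isBigO_one ℝ) (m := 1) τ.size_pos

theorem card_le_weight (s : Forest) : Multiset.card s ≤ weight s := by
  induction s using Multiset.induction_on with
  | empty => simp
  | cons t s ih =>
    rw [Multiset.card_cons, weight_cons]
    have := t.size_pos
    omega

/-- The expansion of `f` along a B-series. -/
theorem vectorField_truncSeries_isBigO (f : VectorField N) (φ : Character) (n : ℕ) (y : Space N) :
    (fun p : ℝ × Space N => f.toFun (p.2 + truncSeries f (fun τ => φ (X τ)) n p) -
      ∑ s ∈ forestsLE n, forestTerm f (fun s => φ (ofForest s)) p s)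
      =O[𝓝 ((0 : ℝ), y)] fun p => p.1 ^ (n + 1) := by
  set B := truncSeries f (fun τ => φ (X τ)) n with hB
  have ht : Tendsto (fun p : ℝ × Space N => (p.2, B p)) (𝓝 ((0 : ℝ), y)) (𝓝 (y, 0)) := by
    have := (continuous_snd.prodMk (continuous_truncSeries f (fun τ => φ (X τ)) n)).tendsto
      ((0 : ℝ), y)
    rwa [truncSeries_zero_left] at this
  have h1 := (taylor_isBigO f.smooth y n).comp_tendsto ht
  have h2 : (fun p => ‖B p‖ ^ (n + 1)) =O[𝓝 ((0 : ℝ), y)] fun p => p.1 ^ (n + 1) :=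
    ((truncSeries_isBigO f _ n y).norm_left).pow (n + 1)
  have h3 := h1.trans h2
  -- All forests produced by the Taylor polynomial. Every forest with at most n vertices is among
  -- them, since it has at most n trees; the others are of order at least n + 1 in h.
  let S : Finset Forest := ((Finset.range (n + 1)).sigma fun k => (treesLE n).sym k).image
    fun q => q.2.1
  have hS : ∀ p, ∑ k ∈ Finset.range (n + 1), (k.factorial : ℝ)⁻¹ •
      (iteratedFDeriv ℝ k f.toFun p.2 fun _ => B p) =
        ∑ s ∈ S, forestTerm f (fun s => φ (ofForest s)) p s := by
    intro p
    simp only [hB, taylor_term_truncSeries]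
    rw [Finset.sum_sigma', Finset.sum_image]
    rintro ⟨k, s, hs⟩ _ ⟨l, t, ht⟩ _ hst
    simp only at hst
    subst hst
    subst hs
    subst ht
    rfl
  have hsub : forestsLE n ⊆ S := by
    intro s hs
    rw [mem_forestsLE] at hs
    refine Finset.mem_image.2 ⟨⟨Multiset.card s, ⟨s, rfl⟩⟩, ?_, rfl⟩
    rw [Finset.mem_sigma, Finset.mem_range, Finset.mem_sym_iff]
    refine ⟨Nat.lt_succ_of_le ((card_le_weight s).trans hs), fun t ht => ?_⟩
    rw [mem_treesLE]
    exact (size_le_weight ht).trans hs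
  have h4 : (fun p => ∑ s ∈ S \ forestsLE n, forestTerm f (fun s => φ (ofForest s)) p s)
      =O[𝓝 ((0 : ℝ), y)] fun p => p.1 ^ (n + 1) := by
    refine IsBigO.fun_sum fun s hs => forestTerm_isBigO f _ y ?_
    rw [Finset.mem_sdiff, mem_forestsLE] at hs
    omega
  refine (h3.add h4).congr_left fun p => ?_
  simp only [Function.comp_def]
  rw [hS p, ← Finset.sum_sdiff hsub]
  abel

/-! ## Composition of B-series -/

theorem sum_forestTerm_combination (f : VectorField N) {n : ℕ} (c : Character →₀ ℝ)
    (b : Character → Forest → ℝ) {a : Forest → ℝ}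
    (h : ∀ s, weight s ≤ n → a s = c.sum fun ξ r => r * b ξ s) (p : ℝ × Space N) :
    ∑ s ∈ forestsLE n, forestTerm f a p s =
      ∑ ξ ∈ c.support, c ξ • ∑ s ∈ forestsLE n, forestTerm f (b ξ) p s := by
  simp only [Finset.smul_sum]
  rw [Finset.sum_comm]
  refine Finset.sum_congr rfl fun s hs => ?_
  simp only [forestTerm, h s (mem_forestsLE.1 hs), Finsupp.sum, Finset.mul_sum, Finset.sum_smul,
    Finset.smul_sum]
  refine Finset.sum_congr rfl fun ξ _ => ?_
  simp only [smul_smul]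
  congr 1
  ring

theorem truncSeries_sub_isBigO (f : VectorField N) (a : Tree → ℝ) {n m : ℕ} (h : n ≤ m)
    (y : Space N) :
    (fun p => truncSeries f a m p - truncSeries f a n p) =O[𝓝 ((0 : ℝ), y)]
      fun p => p.1 ^ (n + 1) := by
  have hsub : treesLE n ⊆ treesLE m := fun τ hτ => by
    rw [mem_treesLE] at hτ ⊢
    omega
  have e : (fun p => truncSeries f a m p - truncSeries f a n p) = fun p : ℝ × Space N =>
      ∑ τ ∈ treesLE m \ treesLE n, p.1 ^ τ.size • ((τ.symm : ℝ)⁻¹ * a τ) • τ.elemDiff f p.2 := by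
    funext p
    rw [truncSeries, truncSeries, ← Finset.sum_sdiff hsub, add_sub_cancel_right]
  rw [e]
  refine IsBigO.fun_sum fun τ hτ => ?_
  rw [Finset.mem_sdiff, mem_treesLE, mem_treesLE] at hτ
  exact isBigO_pow_smul (continuous_fst.tendsto ((0 : ℝ), y))
    (((continuous_smul_elemDiff f _ τ).tendsto (0, y)).isBigO_one ℝ) (by omega)

/-- Strict differentiability makes g Lipschitz near y. -/
theorem isBigO_comp_sub {E G : Type*} [NormedAddCommGroup E] [NormedSpace ℝ E]
    [NormedAddCommGroup G] [NormedSpace ℝ G] {g : E → G} (hg : ContDiff ℝ ∞ g) {α : Type*}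
    {l : Filter α} {u v : α → E} {y : E} (hu : Tendsto u l (𝓝 y)) (hv : Tendsto v l (𝓝 y))
    {w : α → ℝ} (huv : (fun a => u a - v a) =O[l] w) :
    (fun a => g (u a) - g (v a)) =O[l] w :=
  ((hg.contDiffAt.hasStrictFDerivAt (by simp)).isBigO_sub.comp_tendsto
    (hu.prodMk_nhds hv)).trans huv

theorem tendsto_truncSeries (f : VectorField N) (a : Tree → ℝ) (n : ℕ) {y : Space N}
    {z : ℝ → Space N} (hz : Tendsto z (𝓝 0) (𝓝 y)) :
    Tendsto (fun h => z h + truncSeries f a n (h, z h)) (𝓝 0) (𝓝 y) := by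
  have h1 : Tendsto (fun h => (h, z h)) (𝓝 0) (𝓝 ((0 : ℝ), y)) := tendsto_id.prodMk_nhds hz
  have h2 := ((continuous_truncSeries f a n).tendsto ((0 : ℝ), y)).comp h1
  rw [truncSeries_zero_left] at h2
  simpa using hz.add h2

/-- Substituting one truncated B-series into another one corresponds to the convolution of the
characters. -/
theorem truncSeries_substitute (f : VectorField N) (φ : Character) (y : Space N) (m n : ℕ)
    (hn : n ≤ m) (χ : Character) {z : ℝ → Space N}
    (hz : z = fun h => y + truncSeries f (fun τ => φ (X τ)) m (h, y)) :
    (fun h => z h + truncSeries f (fun τ => χ (X τ)) n (h, z h) -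
      (y + truncSeries f (fun τ => (φ * χ) (X τ)) n (h, y))) =O[𝓝 0] fun h => h ^ (n + 1) := by
  have hy : Tendsto (fun h : ℝ => (h, y)) (𝓝 0) (𝓝 (0, y)) :=
    tendsto_id.prodMk_nhds tendsto_const_nhds
  have hzt : Tendsto z (𝓝 0) (𝓝 y) := by
    rw [hz]
    exact tendsto_truncSeries f _ m tendsto_const_nhds
  have hzp : Tendsto (fun h : ℝ => (h, z h)) (𝓝 0) (𝓝 (0, y)) := tendsto_id.prodMk_nhds hzt
  have hzφ : ∀ k ≤ m, (fun h => z h - (y + truncSeries f (fun τ => φ (X τ)) k (h, y)))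
      =O[𝓝 0] fun h => h ^ (k + 1) := fun k hk => by
    refine ((truncSeries_sub_isBigO f (fun τ => φ (X τ)) hk y).comp_tendsto hy).congr_left
      fun h => ?_
    simp only [Function.comp_def, hz]
    abel
  -- The truncation `m` of the inner series stays fixed. The induction hypothesis is needed for all
  -- the characters ξ into which χ ∘ `graft` is decomposed.
  induction n generalizing χ with
  | zero =>
    have h0 : ∀ a p, truncSeries f a 0 p = 0 := fun a p =>
      Finset.sum_eq_zero fun τ hτ => absurd (mem_treesLE.1 hτ) (by have := τ.size_pos; omega)
    simpa only [h0, add_zero] using hzφ 0 hn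
  | succ n ih =>
    obtain ⟨c, hc⟩ := exists_combination_of_characters (χ.toLinearMap ∘ₗ graft) n
    have e1 : ∀ p, ∑ s ∈ forestsLE n, forestTerm f (fun s => χ (X (Tree.node s))) p s =
        ∑ ξ ∈ c.support, c ξ • ∑ s ∈ forestsLE n, forestTerm f (fun s => ξ (ofForest s)) p s := by
      refine sum_forestTerm_combination f c (fun ξ s => ξ (ofForest s)) fun s hs => ?_
      rw [← hc _ (ofForest_mem_lowerForests (Nat.lt_succ_of_le hs))]
      simp
    -- By `conv_graft`, (φ * χ)([s]) = φ([s]) + χ([translate φ s]). The combination found for χ ∘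
    -- `graft` also applies to the translated forest, because translation does not raise the weight.
    have e2 : ∀ p, ∑ s ∈ forestsLE n, forestTerm f (fun s => (φ * χ) (X (Tree.node s))) p s =
        ∑ s ∈ forestsLE n, forestTerm f (fun s => φ (X (Tree.node s))) p s +
          ∑ ξ ∈ c.support, c ξ •
            ∑ s ∈ forestsLE n, forestTerm f (fun s => (φ * ξ) (ofForest s)) p s := by
      intro p
      rw [← sum_forestTerm_combination f c (fun ξ s => (φ * ξ) (ofForest s))
        (a := fun s => χ (graft (translate φ (ofForest s)))), ← Finset.sum_add_distrib]
      · refine Finset.sum_congr rfl fun s _ => ?_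
        simp only [forestTerm, ← conv_eq_mul, ← graft_ofForest, conv_graft]
        rw [← smul_add, ← add_smul, mul_add]
      · intro s hs
        have := hc _ (lowerForests_mono (Nat.succ_le_succ hs) (translate_ofForest_mem φ s))
        simp only [LinearMap.comp_apply, AlgHom.toLinearMap_apply] at this
        rw [this]
        simp only [← conv_eq_mul, conv_eq_comp, AlgHom.comp_apply]
    -- The two sums expand f at B_ξ(z) and at B_{φ*ξ}(y), which agree to this order by the induction
    -- hypothesis.
    have hD : ∀ ξ : Character, (fun h =>
        ∑ s ∈ forestsLE n, forestTerm f (fun s => ξ (ofForest s)) (h, z h) s -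
          ∑ s ∈ forestsLE n, forestTerm f (fun s => (φ * ξ) (ofForest s)) (h, y) s)
        =O[𝓝 0] fun h => h ^ (n + 1) := by
      intro ξ
      have h1 := (vectorField_truncSeries_isBigO f ξ n y).comp_tendsto hzp
      have h2 := (vectorField_truncSeries_isBigO f (φ * ξ) n y).comp_tendsto hy
      have h3 := isBigO_comp_sub f.smooth
        (tendsto_truncSeries f (fun τ => ξ (X τ)) n hzt)
        (tendsto_truncSeries f (fun τ => (φ * ξ) (X τ)) n (tendsto_const_nhds (x := y)))
        (ih (by omega) ξ)
      refine ((h2.sub h1).add h3).congr_left fun h => ?_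
      simp only [Function.comp_def]
      abel
    have hsum : (fun h => ∑ ξ ∈ c.support, c ξ •
        (∑ s ∈ forestsLE n, forestTerm f (fun s => ξ (ofForest s)) (h, z h) s -
          ∑ s ∈ forestsLE n, forestTerm f (fun s => (φ * ξ) (ofForest s)) (h, y) s))
        =O[𝓝 0] fun h => h ^ (n + 1) :=
      IsBigO.fun_sum fun ξ _ => (hD ξ).const_smul_left (c ξ)
    -- The factor h from the root gains the missing order.
    have hmul := (isBigO_refl (fun h : ℝ => h) (𝓝 0)).smul hsum
    have hmul' := hmul.congr_right (g₂ := fun h : ℝ => h ^ (n + 1 + 1)) fun h => by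
      rw [smul_eq_mul, ← pow_succ']
    refine (hmul'.add (hzφ (n + 1) hn)).congr_left fun h => ?_
    simp only [truncSeries_succ, e1, e2, smul_sub, Finset.sum_sub_distrib, smul_add]
    abel

theorem bSeries_zero (φ : Character) (f : VectorField N) (y : Space N) :
    bSeries φ N f 0 y = y := by
  simp [bSeries]

theorem sum_bSeries (φ : Character) (f : VectorField N) (l : ℕ) (h : ℝ) (y : Space N) :
    ∑ k ∈ Finset.range (l + 1), h ^ k • bSeries φ N f k y =
      y + truncSeries f (fun τ => φ (X τ)) l (h, y) := by
  induction l with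
  | zero =>
    rw [truncSeries, Finset.sum_eq_zero (s := treesLE 0)]
    · simp [bSeries_zero]
    · exact fun τ hτ => absurd (mem_treesLE.1 hτ) (by have := τ.size_pos; omega)
  | succ l ih =>
    rw [Finset.sum_range_succ, ih, add_assoc]
    congr 1
    have hu : treesLE (l + 1) = treesLE l ∪ treesOfSize (l + 1) := by
      ext τ
      rw [Finset.mem_union, mem_treesLE, mem_treesLE, mem_treesOfSize]
      omega
    have hd : Disjoint (treesLE l) (treesOfSize (l + 1)) := by
      refine Finset.disjoint_left.2 fun τ h1 h2 => ?_
      rw [mem_treesLE] at h1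
      rw [mem_treesOfSize] at h2
      omega
    rw [truncSeries, truncSeries, hu, Finset.sum_union hd]
    congr 1
    simp only [bSeries, Nat.succ_ne_zero, if_false, Finset.smul_sum]
    refine Finset.sum_congr rfl fun τ hτ => ?_
    rw [mem_treesOfSize.1 hτ]

theorem contDiff_bSeries (φ : Character) (f : VectorField N) (n : ℕ) :
    ContDiff ℝ ∞ (bSeries φ N f n) := by
  by_cases hn : n = 0
  · subst hn
    have : bSeries φ N f 0 = fun y => y := funext fun y => bSeries_zero φ f y
    rw [this]
    exact contDiff_id
  · have : bSeries φ N f n = fun y =>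
        ∑ τ ∈ treesOfSize n, ((τ.symm : ℝ)⁻¹ * φ (X τ)) • τ.elemDiff f y := by
      funext y
      simp [bSeries, hn]
    rw [this]
    refine ContDiff.sum fun τ _ => ?_
    have := Tree.contDiff_elemDiff f τ
    fun_prop

/-- B-series methods compose by convolution of their characters. -/
theorem bSeries_mul (φ χ : Character) :
    bSeries (φ * χ) = (bSeries χ).comp (bSeries φ) := by
  funext N f m y
  set Ψ := bSeries φ N f with hΨ
  let curve : ℕ → ℝ → Space N := fun l h => ∑ k ∈ Finset.range (l + 1), h ^ k • Ψ k y
  have hcurve : ∀ l h, curve l h = y + truncSeries f (fun τ => φ (X τ)) l (h, y) :=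
    fun l h => sum_bSeries φ f l h y
  have hy : Tendsto (fun h : ℝ => (h, y)) (𝓝 0) (𝓝 (0, y)) :=
    tendsto_id.prodMk_nhds tendsto_const_nhds
  have hct : ∀ l, Tendsto (curve l) (𝓝 0) (𝓝 y) := fun l => by
    rw [funext (hcurve l)]
    exact tendsto_truncSeries f _ l tendsto_const_nhds
  have hcs : ∀ l, ContDiff ℝ ∞ (curve l) := fun l =>
    ContDiff.sum fun k _ => (contDiff_id.pow k).smul contDiff_const
  -- The inner curve is truncated at order m - p for every l, so `T p l` is literally `taylorCoeff`
  -- only for l = m - p. That is the only case that enters the coefficient of h^m.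
  let T : ℕ → ℕ → Space N := fun p l =>
    (l.factorial : ℝ)⁻¹ • iteratedDeriv l (fun h => bSeries χ N f p (curve (m - p) h)) 0
  have h1 : ∀ p ∈ Finset.range (m + 1),
      (fun h : ℝ => h ^ p • bSeries χ N f p (curve m h) -
        ∑ l ∈ Finset.range (m + 1 - p), h ^ (p + l) • T p l) =O[𝓝 0] fun h => h ^ (m + 1) := by
    intro p hp
    have hpm : p ≤ m := Nat.lt_succ_iff.1 (Finset.mem_range.1 hp)
    have t1 := taylor_curve_isBigO ((contDiff_bSeries χ f p).comp (hcs (m - p))) (m - p)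
    have t2 : (fun h => curve m h - curve (m - p) h) =O[𝓝 0] fun h => h ^ (m - p + 1) := by
      refine ((truncSeries_sub_isBigO f (fun τ => φ (X τ)) (Nat.sub_le m p) y).comp_tendsto
        hy).congr_left fun h => ?_
      rw [hcurve, hcurve]
      simp only [Function.comp_def]
      abel
    have t3 := isBigO_comp_sub (contDiff_bSeries χ f p) (hct m) (hct (m - p)) t2
    have t4 := (isBigO_refl (fun h : ℝ => h ^ p) (𝓝 0)).smul (t3.add t1)
    refine (t4.congr_left fun h => ?_).congr_right fun h => ?_
    · rw [show m + 1 - p = m - p + 1 by omega]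
      simp only [pow_add, ← smul_smul, ← Finset.smul_sum, ← smul_sub]
      congr 1
      simp only [Function.comp_def, sub_add_sub_cancel]
      rfl
    · rw [smul_eq_mul, ← pow_add]
      congr 1
      omega
  have h2 := IsBigO.fun_sum h1
  have h3 := truncSeries_substitute f φ y m m le_rfl χ (funext (hcurve m))
  -- Two polynomials of degree at most m that both agree with the composite up to O(h^(m+1)) have
  -- equal coefficients.
  have h4 : (fun h : ℝ => ∑ k ∈ Finset.range (m + 1), h ^ k •
      (∑ p ∈ Finset.range (k + 1), T p (k - p) - bSeries (φ * χ) N f k y)) =O[𝓝 0]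
      fun h => h ^ (m + 1) := by
    refine (h3.sub h2).congr_left fun h => ?_
    have e : ∑ k ∈ Finset.range (m + 1), h ^ k • ∑ p ∈ Finset.range (k + 1), T p (k - p) =
        ∑ p ∈ Finset.range (m + 1), ∑ l ∈ Finset.range (m + 1 - p), h ^ (p + l) • T p l := by
      rw [← Finset.sum_range_diag_flip]
      refine Finset.sum_congr rfl fun k _ => ?_
      rw [Finset.smul_sum]
      refine Finset.sum_congr rfl fun p hp => ?_
      rw [Nat.add_sub_cancel' (Nat.lt_succ_iff.1 (Finset.mem_range.1 hp))]
    simp only [smul_sub, Finset.sum_sub_distrib, sum_bSeries, e]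
    abel
  have h5 := coeff_eq_zero_of_isBigO h4 m le_rfl
  rw [sub_eq_zero] at h5
  rw [← h5]
  exact (Finset.Nat.sum_antidiagonal_eq_sum_range_succ
    (fun p l => FormalMap.taylorCoeff (bSeries χ N f p) Ψ l y) m).symm

/-! ## Adjoint methods -/

theorem bSeries_one : bSeries 1 = Method.id := by
  funext N f n y
  by_cases hn : n = 0
  · simp [bSeries, Method.id, FormalMap.id, hn]
  · simp [bSeries, Method.id, FormalMap.id, hn, one_eq_counit, counit_X]

theorem reverse_bSeries (φ : Character) : (bSeries φ).reverse = bSeries φ.bar := by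
  funext N f n y
  by_cases hn : n = 0
  · subst hn
    simp [Method.reverse, FormalMap.reverse, bSeries_zero]
  · simp only [Method.reverse, FormalMap.reverse, bSeries, hn, if_false, Finset.smul_sum]
    refine Finset.sum_congr rfl fun τ hτ => ?_
    rw [bar_X, mem_treesOfSize.1 hτ, smul_smul]
    congr 1
    ring

theorem isAdjoint_bSeries (φ : Character) : (bSeries φ).IsAdjoint (bSeries φ.adjoint) := by
  rw [Method.IsAdjoint, reverse_bSeries, ← bSeries_mul, ← bSeries_mul, adjoint_eq, mul_inv_cancel,
    inv_mul_cancel, bSeries_one]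
  exact ⟨rfl, rfl⟩

/-! ### Uniqueness of the adjoint method -/

theorem taylorCoeff_congr {g : Space N → Space N} {Ψ Ψ' : FormalMap N} {l : ℕ} {y : Space N}
    (h : ∀ k ≤ l, Ψ k y = Ψ' k y) :
    FormalMap.taylorCoeff g Ψ l y = FormalMap.taylorCoeff g Ψ' l y := by
  unfold FormalMap.taylorCoeff
  congr 2
  funext t
  congr 1
  refine Finset.sum_congr rfl fun k hk => ?_
  rw [h k (Nat.lt_succ_iff.1 (Finset.mem_range.1 hk))]

/-- A polynomial curve is its own Taylor polynomial. -/
theorem taylorCoeff_id (Ψ : FormalMap N) (l : ℕ) (y : Space N) :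
    FormalMap.taylorCoeff (fun x => x) Ψ l y = Ψ l y := by
  have hs : ContDiff ℝ ∞ fun h : ℝ => ∑ k ∈ Finset.range (l + 1), h ^ k • Ψ k y :=
    ContDiff.sum fun k _ => (contDiff_id.pow k).smul contDiff_const
  have h := taylor_curve_isBigO hs l
  have h' : (fun t : ℝ => ∑ k ∈ Finset.range (l + 1), t ^ k • (Ψ k y - (k.factorial : ℝ)⁻¹ •
      iteratedDeriv k (fun h : ℝ => ∑ k ∈ Finset.range (l + 1), h ^ k • Ψ k y) 0)) =O[𝓝 0]
      fun t => t ^ (l + 1) := by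
    refine h.congr_left fun t => ?_
    simp only [smul_sub, Finset.sum_sub_distrib]
  exact (sub_eq_zero.1 (coeff_eq_zero_of_isBigO h' l le_rfl)).symm

/-- Right inverses of formal maps that start with the identity are unique. -/
theorem FormalMap.eq_of_comp_eq {Φ Ψ Ψ' : FormalMap N} (h0 : Φ 0 = fun x => x)
    (h : Φ.comp Ψ = Φ.comp Ψ') : Ψ = Ψ' := by
  funext m y
  induction m using Nat.strong_induction_on with
  | _ m ih =>
    have hm := congrFun (congrFun h m) y
    simp only [FormalMap.comp] at hm
    have hmem : ((0, m) : ℕ × ℕ) ∈ Finset.HasAntidiagonal.antidiagonal m := by simp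
    -- The index (0, m) contributes the m-th coefficient itself, since Φ starts with the identity;
    -- all other indices involve only coefficients of lower order.
    rw [← Finset.add_sum_erase _ _ hmem, ← Finset.add_sum_erase _ _ hmem, h0, taylorCoeff_id,
      taylorCoeff_id] at hm
    refine add_right_cancel (hm.trans (congrArg _ (Finset.sum_congr rfl fun p hp => ?_)))
    obtain ⟨hne, hp⟩ := Finset.mem_erase.1 hp
    rw [Finset.HasAntidiagonal.mem_antidiagonal] at hp
    have hp1 : p.1 ≠ 0 := fun h => hne (Prod.ext h (by simp only; omega))
    exact taylorCoeff_congr fun k hk => (ih k (by omega)).symm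

/-- Only the right-inverse half of `IsAdjoint` is used, and Ψ, Ψ' need not be B-series or smooth in
y. -/
theorem isAdjoint_unique {φ : Character} {Ψ Ψ' : Method} (h : (bSeries φ).IsAdjoint Ψ)
    (h' : (bSeries φ).IsAdjoint Ψ') : Ψ = Ψ' := by
  funext N f
  refine FormalMap.eq_of_comp_eq (Φ := (bSeries φ).reverse N f) ?_
    (congrFun (congrFun (h.2.trans h'.2.symm) N) f)
  rw [reverse_bSeries]
  exact funext fun y => bSeries_zero _ f y

end BSeries

end

/-! ### The symmetric decomposition -/

theorem mainTheorem1 (ψ : BSeries.Character) :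
    ∃ ψm ψp : BSeries.Character,
      -- the symmetric factor, with an odd character
      ψm.IsOdd ∧ (BSeries.bSeries ψm).IsSymmetric ∧
      -- the antisymmetric factor, with an even character
      ψp.IsEven ∧ (BSeries.bSeries ψp).IsAntisymmetric ∧
      -- the decomposition, for the methods and for the characters
      BSeries.bSeries ψ = (BSeries.bSeries ψm).comp (BSeries.bSeries ψp) ∧
      ψ = ψp.conv ψm ∧
      -- the square of the symmetric factor, for the methods and for the characters
      (BSeries.bSeries ψ).IsAdjoint (BSeries.bSeries ψ.adjoint) ∧
      (∀ Ψs : BSeries.Method, (BSeries.bSeries ψ).IsAdjoint Ψs →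
        (BSeries.bSeries ψm).comp (BSeries.bSeries ψm) = (BSeries.bSeries ψ).comp Ψs) ∧
      ψm.conv ψm = ψ.adjoint.conv ψ := by
  obtain ⟨ψm, ψp, hodd, heven, hψ, hsq⟩ := BSeries.exists_even_odd ψ
  refine ⟨ψm, ψp, hodd, ?_, heven, ?_, ?_, hψ, BSeries.isAdjoint_bSeries ψ, ?_, hsq⟩
  -- For an odd character the adjoint character ψ̄⁻¹ is the character itself.
  · have h := BSeries.isAdjoint_bSeries ψm
    rwa [BSeries.adjoint_eq, show ψm.bar = ψm⁻¹ from hodd, inv_inv] at h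
  · rw [BSeries.Method.IsAntisymmetric, BSeries.reverse_bSeries, show ψp.bar = ψp from heven]
  · rw [← BSeries.bSeries_mul, ← hψ]
  · intro Ψs h
    -- Any adjoint is the B-series of ψ*. Composition reverses the order of the characters, so Ψ ∘
    -- Ψ* has character ψ* * ψ.
    rw [BSeries.isAdjoint_unique h (BSeries.isAdjoint_bSeries ψ), ← BSeries.bSeries_mul,
      ← BSeries.bSeries_mul, hsq]
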